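/- Notation. All spaces are real. $H^1(0,1)$ carries the norm $\|v\|_{H^1}^2=\|v\|_{L^2}^2+\|v'\|_{L^2}^2$, $H^1_0(0,1)$ is the closure of $C_c^\infty(0,1)$ in it, and $H^{-1}(0,1)$ is the dual of $H^1_0(0,1)$. For $X>0$ let $\mathbb H_X=\{u\in C([0,X];H^1(0,1)):\ u_x\in C([0,X];L^2(0,1))\}$, with norm $\|u\|_{\mathbb H_X}=\sup_{[0,X]}\|u(x)\|_{H^1}+\sup_{[0,X]}\|u_x(x)\|_{L^2}$. For $u_0\in H^1_0(0,1)$ and $f:[0,X]\to L^2(0,1)$, a weak solution on $[0,X]$ of $$u_{xx}-u_{yy}=f,\qquad u(x,0)=u(x,1)=0,\qquad u(0,y)=u_0(y),\quad u_x(0,y)=0 \tag{1}$$ is a function $u\in\mathbb H_X$ with values in $H^1_0(0,1)$, with $u_{xx}\in L^2(0,X;H^{-1}(0,1))$, $u(0)=u_0$, $u_x(0)=0$, and such that for every $\psi\in H^1_0(0,1)$, $\langle u_{xx},\psi\rangle+\langle u_y,\psi_y\rangle=\langle f,\psi\rangle$ for a.e. $x\in(0,X)$. Theorem. Let $\gamma:(0,1)\to[1,\infty)$,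 $\beta\in(0,1)$, $C_1>0$, and let $P:H^1(0,1)\to L^2(0,1)$ be a linear map with $\|Pv\|_{L^2}\le C_1\log(\gamma(\beta))\,\|v\|_{H^1}$ for all $v\in H^1(0,1)$. Let $u_0\in H^1_0(0,1)$ be the (noisy) initial datum. For $\bar x>0$ let $$\eta(\bar x)=\bigl(2C_1\log(\gamma(\beta))\,\bar x\,\gamma(\beta)^{C_1\bar x}\bigr)^{1/2}.$$ Then $\eta(\bar x)\to0$ as $\bar x\to0^+$. Moreover, let $0<\bar x\le X\le 1$ with $\eta=\eta(\bar x)<1$ (for $X=1$ the problems below are posed on the whole of $[0,1]$, for $X=\bar x$ on $[0,\bar x]$). Then: 1. The regularized problem, that is, (1) with $f=-Pu$, has exactly one weak solution $u$ on $[0,X]$. 2. The linearized iteration, that is, $u^0=0$ and, for $k\ge1$, $u^k$ a weak solution on $[0,X]$ of (1) with $f=-Pu^{k-1}$, determines exactly one sequence $(u^k)_{k\ge0}$. 3. $u$ and all $u^k$ (restricted to $[0,\bar x]$) belong to $\mathbb H_{\bar x}$, and $u^k\to u$ strongly in $\mathbb H_{\bar x}$ as $k\to\infty$. 4. For every $k\ge0$,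 $$\|u^k-u\|_{\mathbb H_{\bar x}}\le\frac{\eta^k}{1-\eta}\,\|u^1\|_{\mathbb H_{\bar x}}.$$ -/

import Mathlib

open MeasureTheory Set Filter Topology
open scoped ContDiff

noncomputable section

namespace QuasiReversibility

/-- `φ` is a test function on the open interval `(a, b)`, i.e. `φ ∈ C_c^∞(a, b)`. -/
def IsTestFunction (a b : ℝ) (φ : ℝ → ℝ) : Prop :=
  ContDiff ℝ ∞ φ ∧ HasCompactSupport φ ∧ tsupport φ ⊆ Ioo a b

/-- Lebesgue measure on `(0, 1)`. -/
abbrev vol01 : Measure ℝ := volume.restrict (Ioo (0 : ℝ) 1)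

/-- The real Hilbert space `L²(0, 1)`. -/
abbrev L2 : Type := Lp ℝ 2 vol01

/-- A continuous compactly supported function times an `L²(0,1)` function is integrable. -/
theorem integrable_mul_of_test (f : L2) {φ : ℝ → ℝ} (hc : Continuous φ)
    (hs : HasCompactSupport φ) : Integrable (fun y => f y * φ y) vol01 :=
  MemLp.integrable_mul (p := 2) (q := 2) (Lp.memLp f) (hc.memLp_of_hasCompactSupport hs)

/-- The pairs `(v, v')` of `L²(0,1)` functions such that `v'` is the weak derivative of `v`,
as a subspace of the Hilbert sum `L²(0,1) ⊕ L²(0,1)`. -/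
def h1Submodule : Submodule ℝ (WithLp 2 (L2 × L2)) where
  carrier := {p | ∀ φ : ℝ → ℝ, IsTestFunction 0 1 φ →
    ∫ y, p.fst y * deriv φ y ∂vol01 = -∫ y, p.snd y * φ y ∂vol01}
  zero_mem' := by
    intro φ _
    have h : ⇑(0 : L2) =ᵐ[vol01] 0 := Lp.coeFn_zero _ _ _
    have h1 : ∫ y, (0 : L2) y * deriv φ y ∂vol01 = 0 := by
      rw [integral_eq_zero_of_ae]
      filter_upwards [h] with y hy
      rw [hy, Pi.zero_apply, zero_mul]
    have h2 : ∫ y, (0 : L2) y * φ y ∂vol01 = 0 := by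
      rw [integral_eq_zero_of_ae]
      filter_upwards [h] with y hy
      rw [hy, Pi.zero_apply, zero_mul]
    change ∫ y, (0 : L2) y * deriv φ y ∂vol01 = -∫ y, (0 : L2) y * φ y ∂vol01
    rw [h1, h2, neg_zero]
  add_mem' := by
    intro p q hp hq φ hφ
    have hd : Continuous (deriv φ) := hφ.1.continuous_deriv (by simp)
    have key : ∀ (f g : L2) (χ : ℝ → ℝ), Continuous χ → HasCompactSupport χ →
        ∫ y, (f + g : L2) y * χ y ∂vol01
          = ∫ y, f y * χ y ∂vol01 + ∫ y, g y * χ y ∂vol01 := by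
      intro f g χ hc hs
      rw [← integral_add (integrable_mul_of_test f hc hs) (integrable_mul_of_test g hc hs)]
      refine integral_congr_ae ?_
      filter_upwards [Lp.coeFn_add f g] with y hy
      rw [hy, Pi.add_apply, add_mul]
    change ∫ y, (p.fst + q.fst : L2) y * deriv φ y ∂vol01
      = -∫ y, (p.snd + q.snd : L2) y * φ y ∂vol01
    rw [key _ _ _ hd hφ.2.1.deriv, key _ _ _ hφ.1.continuous hφ.2.1, hp φ hφ, hq φ hφ, neg_add]
  smul_mem' := by
    intro c p hp φ hφ
    have key : ∀ (f : L2) (χ : ℝ → ℝ),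
        ∫ y, (c • f : L2) y * χ y ∂vol01 = c * ∫ y, f y * χ y ∂vol01 := by
      intro f χ
      rw [← integral_const_mul]
      refine integral_congr_ae ?_
      filter_upwards [Lp.coeFn_smul c f] with y hy
      rw [hy, Pi.smul_apply, smul_eq_mul, mul_assoc]
    change ∫ y, (c • p.fst : L2) y * deriv φ y ∂vol01
      = -∫ y, (c • p.snd : L2) y * φ y ∂vol01
    rw [key, key, hp φ hφ, mul_neg]

/-- The Sobolev space `H¹(0, 1)`, with `‖v‖² = ‖v‖²_{L²} + ‖v'‖²_{L²}`. -/
abbrev H1 : Type := h1Submodule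

/-- The inclusion `H¹(0,1) → L²(0,1)`. -/
def H1.toL2 (v : H1) : L2 := (v : WithLp 2 (L2 × L2)).fst

/-- The weak derivative `∂_y : H¹(0,1) → L²(0,1)`. -/
def H1.dy (v : H1) : L2 := (v : WithLp 2 (L2 × L2)).snd

/-- `H¹₀(0, 1)`, the closure of `C_c^∞(0, 1)` in `H¹(0, 1)`. -/
def H10 : Submodule ℝ H1 :=
  (Submodule.span ℝ {v : H1 | ∃ φ : ℝ → ℝ, IsTestFunction 0 1 φ ∧
    v.toL2 =ᵐ[vol01] φ}).topologicalClosure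

/-- The derivative `∂_x u : [0, X] → L²(0,1)` (one-sided at the two endpoints). -/
def dx (X : ℝ) (u : ℝ → H1) (x : ℝ) : L2 :=
  derivWithin (fun s => (u s).toL2) (Icc 0 X) x

/-- `u ∈ C([0,X]; H¹(0,1))` with `∂_x u ∈ C([0,X]; L²(0,1))`.  Only the values of `u` on `[0, X]`
matter. -/
structure MemHX (X : ℝ) (u : ℝ → H1) : Prop where
  continuousOn : ContinuousOn u (Icc 0 X)
  differentiableOn : DifferentiableOn ℝ (fun s => (u s).toL2) (Icc 0 X)
  continuousOn_dx : ContinuousOn (dx X u) (Icc 0 X)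

/-- The norm `‖u‖_{C([0,X]; H¹(0,1))} + ‖∂_x u‖_{C([0,X]; L²(0,1))}`. -/
def normHX (X : ℝ) (u : ℝ → H1) : ℝ :=
  (⨆ x : Icc (0 : ℝ) X, ‖u x‖) + ⨆ x : Icc (0 : ℝ) X, ‖dx X u x‖

/-- `z ∈ L²(0,X; H⁻¹(0,1))`, where `H⁻¹` is the dual of `H¹₀`, is the second derivative
`∂²u/∂x²`, i.e. the distributional derivative of `∂_x u : (0,X) → L² ⊆ H⁻¹`. -/
def IsSecondDx (X : ℝ) (u : ℝ → H1) (z : ℝ → (H10 →L[ℝ] ℝ)) : Prop :=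
  MemLp z 2 (volume.restrict (Ioo 0 X)) ∧
  ∀ ψ : H10, ∀ φ : ℝ → ℝ, IsTestFunction 0 X φ →
    ∫ x in Ioo 0 X, deriv φ x * inner ℝ (dx X u x) (ψ : H1).toL2
      = -∫ x in Ioo 0 X, φ x * z x ψ

/-- `u` is a weak solution on `[0, X] × [0, 1]` of `u_xx - u_yy = f`, `u(x,0) = u(x,1) = 0`,
`u(0,y) = u₀(y)`, `u_x(0,y) = 0`. -/
structure IsWeakSolution (X : ℝ) (u₀ : H1) (f : ℝ → L2) (u : ℝ → H1) : Prop where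
  memHX : MemHX X u
  mem_H10 : ∀ x ∈ Icc 0 X, u x ∈ H10
  weak_form : ∃ z : ℝ → (H10 →L[ℝ] ℝ), IsSecondDx X u z ∧
    ∀ ψ : H10, ∀ᵐ x ∂(volume.restrict (Ioo 0 X)),
      z x ψ + inner ℝ (u x).dy (ψ : H1).dy = inner ℝ (f x) (ψ : H1).toL2
  initial : u 0 = u₀
  initial_dx : dx X u 0 = 0

/-- The stabilized operators: linear maps `P : H¹(0,1) → L²(0,1)` with
`‖P v‖ ≤ C₁ log(g) ‖v‖_{H¹}`, where `g` is the value `γ(β)`. -/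
def IsStabilizedOperator (C₁ g : ℝ) (P : H1 →ₗ[ℝ] L2) : Prop :=
  ∀ v : H1, ‖P v‖ ≤ C₁ * Real.log g * ‖v‖

/-- Weak solutions of the regularized problem `u_xx - u_yy + P u = 0` on `[0, X] × [0, 1]`. -/
def IsRegularizedSolution (P : H1 →ₗ[ℝ] L2) (X : ℝ) (u₀ : H1) (u : ℝ → H1) : Prop :=
  IsWeakSolution X u₀ (fun x => -P (u x)) u

/-- The linearized iteration on `[0, X] × [0, 1]`: `u⁰ = 0` and, for `k ≥ 1`, `uᵏ` is a weak
solution of `uᵏ_xx - uᵏ_yy = -P uᵏ⁻¹` with the boundary and initial data of the regularized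
problem. -/
def IsLinearizedIteration (P : H1 →ₗ[ℝ] L2) (X : ℝ) (u₀ : H1) (U : ℕ → ℝ → H1) : Prop :=
  (∀ x ∈ Icc 0 X, U 0 x = 0) ∧
  ∀ k : ℕ, IsWeakSolution X u₀ (fun x => -P (U k x)) (U (k + 1))

/-- `η = (2 C₁ log(g) x̄ g^{C₁ x̄})^{1/2}`, where `g` is the value `γ(β)`. -/
def eta (C₁ g xbar : ℝ) : ℝ :=
  Real.sqrt (2 * C₁ * Real.log g * xbar * g ^ (C₁ * xbar))

end QuasiReversibility

end

noncomputable section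

namespace QuasiReversibility

/-! On `H10` the operator -∂_yy is diagonal in the sine basis e_n, with eigenvalues ω_n², ω_n =
(n+1)π. Coding the state (u, u_x) by the ℓ² sequence z_n = ω_n⟨e_n,u⟩ + i⟨e_n,u_x⟩ turns the wave
equation into z_n' = -iω_n z_n + i f_n: an isometric rotation group with a source, solved by
Duhamel's formula. Weak solutions and Duhamel solutions coincide on [0,X]
(`IsWeakSolution.eq_duhamel`, `isWeakSolution_duhamel`). So the regularized problem is the
fixed-point equation u = `picard` u, and the iteration is u^{k+1} = `picard` u^k.

Put a = C₁ log γ(β). Since the rotations are isometries, two Picard states differ at x by at most a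
times the integral over [0,x] of the H¹ distance of the inputs. Reading off u costs the factor
√(1+ω_n²)/ω_n ≤ 11/10 and reading off u_x costs 1, so `picard` is Lipschitz in the norm of 𝓗_x̄ with
constant (21/10)·a·x̄ (`normHX_picard_sub_le`). This is at most η (`le_eta`), and the error estimate
follows as in Banach's theorem.

The condition η < 1 only concerns [0, x̄]. On all of [0, X], existence and uniqueness come from the
Volterra structure, by an exponentially weighted norm and Grönwall's inequality
(`exists_unique_weakSolution`). -/

/-! ### Test functions and the Hilbert space H¹(0,1) -/

theorem IsTestFunction.eq_zero_of_notMem {a b : ℝ} {φ : ℝ → ℝ} (hφ : IsTestFunction a b φ) {x : ℝ}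
    (hx : x ∉ Ioo a b) : φ x = 0 :=
  image_eq_zero_of_notMem_tsupport fun h => hx (hφ.2.2 h)

theorem IsTestFunction.differentiable {a b : ℝ} {φ : ℝ → ℝ} (hφ : IsTestFunction a b φ) :
    Differentiable ℝ φ :=
  hφ.1.differentiable (by simp)

theorem IsTestFunction.continuous_deriv {a b : ℝ} {φ : ℝ → ℝ} (hφ : IsTestFunction a b φ) :
    Continuous (deriv φ) :=
  hφ.1.continuous_deriv (by simp)

theorem integral_deriv_test_mul {a b : ℝ} (hab : a ≤ b) {φ g h : ℝ → ℝ}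
    (hφ : IsTestFunction a b φ) (hg : ∀ x, HasDerivAt g (h x) x) (hh : Continuous h) :
    ∫ x in Ioo a b, deriv φ x * g x = -∫ x in Ioo a b, φ x * h x := by
  have h1 := intervalIntegral.integral_mul_deriv_eq_deriv_mul (a := a) (b := b) (u := φ) (v := g)
    (u' := deriv φ) (v' := h) (fun x _ => (hφ.differentiable x).hasDerivAt) (fun x _ => hg x)
    (hφ.continuous_deriv.intervalIntegrable _ _) (hh.intervalIntegrable _ _)
  rw [hφ.eq_zero_of_notMem (x := a) (by simp), hφ.eq_zero_of_notMem (x := b) (by simp)] at h1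
  rw [← integral_Ioc_eq_integral_Ioo, ← integral_Ioc_eq_integral_Ioo,
    ← intervalIntegral.integral_of_le hab, ← intervalIntegral.integral_of_le hab, h1]
  ring

theorem memLp_of_continuous {g : ℝ → ℝ} (hg : Continuous g) : MemLp g 2 vol01 := by
  obtain ⟨C, hC⟩ := isCompact_Icc.exists_bound_of_continuousOn (s := Icc (0 : ℝ) 1) hg.continuousOn
  refine MemLp.of_bound hg.aestronglyMeasurable C ?_
  filter_upwards [ae_restrict_mem measurableSet_Ioo] with x hx
  exact hC x (Ioo_subset_Icc_self hx)

/-- The class in `L²(0,1)` of a continuous function. -/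
def ofCont (g : ℝ → ℝ) (hg : Continuous g) : L2 := (memLp_of_continuous hg).toLp g

theorem coeFn_ofCont (g : ℝ → ℝ) (hg : Continuous g) : ofCont g hg =ᵐ[vol01] g :=
  MemLp.coeFn_toLp _

theorem inner_L2 (f g : L2) : inner ℝ f g = ∫ y, f y * g y ∂vol01 := by
  rw [L2.inner_def]
  refine integral_congr_ae (ae_of_all _ fun y => ?_)
  simp [mul_comm]

theorem inner_ofCont (f : L2) (g : ℝ → ℝ) (hg : Continuous g) :
    inner ℝ f (ofCont g hg) = ∫ y, f y * g y ∂vol01 := by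
  rw [inner_L2]
  refine integral_congr_ae ?_
  filter_upwards [coeFn_ofCont g hg] with y hy
  rw [hy]

theorem inner_H1 (v w : H1) :
    inner ℝ v w = inner ℝ v.toL2 w.toL2 + inner ℝ v.dy w.dy :=
  WithLp.prod_inner_apply _ _

theorem norm_sq_H1 (v : H1) : ‖v‖ ^ 2 = ‖v.toL2‖ ^ 2 + ‖v.dy‖ ^ 2 :=
  WithLp.prod_norm_sq_eq_of_L2 _

/-- The inclusion `H¹(0,1) → L²(0,1)` as a continuous linear map. -/
def toL2L : H1 →L[ℝ] L2 := (WithLp.fstL 2 ℝ L2 L2).comp h1Submodule.subtypeL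

/-- The derivative `H¹(0,1) → L²(0,1)` as a continuous linear map. -/
def dyL : H1 →L[ℝ] L2 := (WithLp.sndL 2 ℝ L2 L2).comp h1Submodule.subtypeL

@[simp] theorem toL2L_apply (v : H1) : toL2L v = v.toL2 := rfl
@[simp] theorem dyL_apply (v : H1) : dyL v = v.dy := rfl

theorem H1.integral_toL2 (v : H1) {φ : ℝ → ℝ} (hφ : IsTestFunction 0 1 φ) :
    ∫ y, v.toL2 y * deriv φ y ∂vol01 = -∫ y, v.dy y * φ y ∂vol01 := v.2 φ hφ

theorem ae_eq_zero_of_test {a b : ℝ} {f : ℝ → ℝ} (hf : IntegrableOn f (Ioo a b))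
    (h : ∀ φ, IsTestFunction a b φ → ∫ y in Ioo a b, f y * φ y = 0) :
    f =ᵐ[volume.restrict (Ioo a b)] 0 := by
  have := isOpen_Ioo.ae_eq_zero_of_integral_contDiff_smul_eq_zero hf.locallyIntegrableOn
    (μ := volume) (fun g hg hs ht => by
      rw [← h g ⟨hg, hs, ht⟩, ← setIntegral_eq_integral_of_forall_compl_eq_zero (s := Ioo a b)]
      · refine integral_congr_ae (ae_of_all _ fun y => ?_)
        simp [mul_comm]
      · intro x hx
        rw [IsTestFunction.eq_zero_of_notMem ⟨hg, hs, ht⟩ hx, zero_smul])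
  exact (ae_restrict_iff' measurableSet_Ioo).2 this

theorem integrable_L2 (f : L2) : Integrable f vol01 := (Lp.memLp f).integrable (by norm_num)

theorem L2_eq_zero_of_test (f : L2)
    (h : ∀ φ, IsTestFunction 0 1 φ → ∫ y, f y * φ y ∂vol01 = 0) : f = 0 := by
  rw [Lp.eq_zero_iff_ae_eq_zero]
  exact ae_eq_zero_of_test (integrable_L2 f) h

/-- The weak derivative is determined by the function. Elements of H¹ can therefore be identified
through their L² sine coefficients alone. -/
theorem H1.ext_toL2 {v w : H1} (h : v.toL2 = w.toL2) : v = w := by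
  have hz : (v - w).toL2 = 0 := by
    rw [← toL2L_apply, map_sub, toL2L_apply, toL2L_apply, h, sub_self]
  have hd : (v - w).dy = 0 := by
    refine L2_eq_zero_of_test _ fun φ hφ => ?_
    have h1 := (v - w).integral_toL2 hφ
    rw [hz] at h1
    rw [← neg_eq_iff_eq_neg.2 h1, neg_eq_zero]
    refine integral_eq_zero_of_ae ?_
    filter_upwards [Lp.coeFn_zero ℝ 2 vol01] with y hy
    rw [hy]; simp
  rw [← sub_eq_zero, ← norm_eq_zero, ← sq_eq_zero_iff, norm_sq_H1, hz, hd]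
  simp

instance : CompleteSpace H1 := by
  refine IsClosed.completeSpace_coe (s := (h1Submodule : Set (WithLp 2 (L2 × L2)))) (hs := ?_)
  -- Each defining condition is an equality of two inner products with fixed L² functions, hence
  -- closed.
  have : (h1Submodule : Set (WithLp 2 (L2 × L2))) = ⋂ (φ : ℝ → ℝ) (hφ : IsTestFunction 0 1 φ),
      {p | inner ℝ p.fst (ofCont _ hφ.continuous_deriv)
        = - inner ℝ p.snd (ofCont _ hφ.1.continuous)} := by
    ext p
    simp only [mem_iInter, inner_ofCont]
    rfl
  rw [this]
  refine isClosed_iInter fun φ => isClosed_iInter fun hφ => isClosed_eq ?_ ?_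
  · exact ((WithLp.fstL 2 ℝ L2 L2).continuous.inner continuous_const)
  · exact ((WithLp.sndL 2 ℝ L2 L2).continuous.inner continuous_const).neg

instance : CompleteSpace H10 :=
  (Submodule.isClosed_topologicalClosure _).completeSpace_coe

/-- The element of `H¹(0,1)` given by a `C¹` function `g` with derivative `h`. -/
def H1.ofDeriv (g h : ℝ → ℝ) (hg : ∀ x, HasDerivAt g (h x) x) (hh : Continuous h) : H1 :=
  ⟨WithLp.toLp 2 (ofCont g (continuous_iff_continuousAt.2 fun x => (hg x).continuousAt),
    ofCont h hh), by
    intro φ hφ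
    have := integral_deriv_test_mul zero_le_one hφ hg hh
    have hgc : Continuous g := continuous_iff_continuousAt.2 fun x => (hg x).continuousAt
    refine (integral_congr_ae ?_).trans (this.trans (congrArg Neg.neg (integral_congr_ae ?_)))
    · filter_upwards [coeFn_ofCont g hgc] with y hy
      exact (congrArg (· * deriv φ y) hy).trans (mul_comm _ _)
    · filter_upwards [coeFn_ofCont h hh] with y hy
      exact (mul_comm _ _).trans (congrArg (· * φ y) hy.symm)⟩

section
variable {g h : ℝ → ℝ} (hg : ∀ x, HasDerivAt g (h x) x) (hh : Continuous h)

theorem H1.toL2_ofDeriv : (H1.ofDeriv g h hg hh).toL2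
    = ofCont g (continuous_iff_continuousAt.2 fun x => (hg x).continuousAt) := rfl

theorem H1.dy_ofDeriv : (H1.ofDeriv g h hg hh).dy = ofCont h hh := rfl

theorem H1.eq_ofDeriv {v : H1} (hv : v.toL2 =ᵐ[vol01] g) : v = H1.ofDeriv g h hg hh :=
  H1.ext_toL2 (Lp.ext (hv.trans (coeFn_ofCont g
    (continuous_iff_continuousAt.2 fun x => (hg x).continuousAt)).symm))

theorem H1.inner_ofDeriv (v : H1) : inner ℝ v (H1.ofDeriv g h hg hh)
    = ∫ y, v.toL2 y * g y ∂vol01 + ∫ y, v.dy y * h y ∂vol01 := by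
  rw [inner_H1, H1.toL2_ofDeriv, H1.dy_ofDeriv, inner_ofCont, inner_ofCont]

end

/-! ### Integration by parts on H¹₀ and a membership criterion -/

theorem ofDeriv_test_mem_H10 {φ : ℝ → ℝ} (hφ : IsTestFunction 0 1 φ) :
    H1.ofDeriv φ (deriv φ) (fun x => (hφ.differentiable x).hasDerivAt) hφ.continuous_deriv
      ∈ H10 :=
  Submodule.le_topologicalClosure _ (Submodule.subset_span ⟨φ, hφ, coeFn_ofCont φ hφ.1.continuous⟩)

/-- Integration by parts between `H¹₀(0,1)` and `C²` functions. -/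
theorem inner_dy_of_mem_H10 {v : H1} (hv : v ∈ H10) {h k : ℝ → ℝ}
    (hh : ∀ x, HasDerivAt h (k x) x) (hk : Continuous k) :
    inner ℝ v.dy (ofCont h (continuous_iff_continuousAt.2 fun x => (hh x).continuousAt))
      = - inner ℝ v.toL2 (ofCont k hk) := by
  set h' := ofCont h (continuous_iff_continuousAt.2 fun x => (hh x).continuousAt)
  -- The defect of the formula is a continuous functional, so it suffices that it vanishes on test
  -- functions.
  let T : H1 →L[ℝ] ℝ := (innerSL ℝ h').comp dyL + (innerSL ℝ (ofCont k hk)).comp toL2L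
  have hT : ∀ w, T w = inner ℝ w.dy h' + inner ℝ w.toL2 (ofCont k hk) := fun w => by
    simp [T, real_inner_comm]
  have hle : H10 ≤ LinearMap.ker (T : H1 →ₗ[ℝ] ℝ) := by
    refine Submodule.topologicalClosure_minimal _ (Submodule.span_le.2 ?_) T.isClosed_ker
    rintro w ⟨φ, hφ, hw⟩
    have hw' := H1.eq_ofDeriv (fun x => (hφ.differentiable x).hasDerivAt) hφ.continuous_deriv hw
    change T w = 0
    rw [hT, inner_ofCont, inner_ofCont, integral_congr_ae (g := fun y => deriv φ y * h y),
      integral_congr_ae (f := fun y => w.toL2 y * k y) (g := fun y => φ y * k y),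
      integral_deriv_test_mul zero_le_one hφ hh hk, neg_add_cancel]
    · filter_upwards [hw] with y hy
      rw [hy]
    · rw [hw', H1.dy_ofDeriv]
      filter_upwards [coeFn_ofCont _ hφ.continuous_deriv] with y hy
      rw [hy]
  have := hle hv
  change T v = 0 at this
  rw [hT] at this
  linarith

theorem tendsto_integral_L2_mul (f : L2) {F : ℕ → ℝ → ℝ} {G : ℝ → ℝ} (hF : ∀ k, Continuous (F k))
    {C : ℝ} (hC : ∀ k, ∀ y ∈ Ioo (0 : ℝ) 1, |F k y| ≤ C)
    (hlim : ∀ y ∈ Ioo (0 : ℝ) 1, Tendsto (fun k => F k y) atTop (𝓝 (G y))) :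
    Tendsto (fun k => ∫ y, f y * F k y ∂vol01) atTop (𝓝 (∫ y, f y * G y ∂vol01)) := by
  have hf := integrable_L2 f
  refine tendsto_integral_of_dominated_convergence (fun y => ‖f y‖ * C) (fun k => ?_)
    (hf.norm.mul_const C) (fun k => ?_) ?_
  · exact hf.aestronglyMeasurable.mul (hF k).aestronglyMeasurable
  · filter_upwards [ae_restrict_mem measurableSet_Ioo] with y hy
    rw [norm_mul]
    exact mul_le_mul_of_nonneg_left (hC k y hy) (norm_nonneg _)
  · filter_upwards [ae_restrict_mem measurableSet_Ioo] with y hy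
    exact (hlim y hy).const_mul _

/-- A smooth function that is `0` on `(-∞, 1]` and `1` on `[2, ∞)`. -/
def cutoff (r : ℝ) : ℝ := Real.smoothTransition (r - 1)

theorem contDiff_cutoff : ContDiff ℝ ∞ cutoff :=
  Real.smoothTransition.contDiff.comp (contDiff_id.sub contDiff_const)

theorem cutoff_of_le {r : ℝ} (h : r ≤ 1) : cutoff r = 0 :=
  Real.smoothTransition.zero_of_nonpos (by linarith)

theorem cutoff_of_ge {r : ℝ} (h : 2 ≤ r) : cutoff r = 1 :=
  Real.smoothTransition.one_of_one_le (by linarith)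

theorem abs_cutoff_le (r : ℝ) : |cutoff r| ≤ 1 := by
  rw [cutoff, abs_of_nonneg (Real.smoothTransition.nonneg _)]
  exact Real.smoothTransition.le_one _

theorem deriv_cutoff_of_gt {r : ℝ} (h : 2 < r) : deriv cutoff r = 0 := by
  have : cutoff =ᶠ[𝓝 r] fun _ => 1 := by
    filter_upwards [lt_mem_nhds h] with s hs using cutoff_of_ge hs.le
  rw [this.deriv_eq, deriv_const]

/-- Differentiating `cutoff` at (k+1)·y(1-y) produces a factor k+1. Against a function of size
K·y(1-y) only the product r·cutoff'(r) remains, bounded uniformly in k. -/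
theorem exists_bound_deriv_cutoff : ∃ M, 0 ≤ M ∧ ∀ r, 0 ≤ r → |deriv cutoff r * r| ≤ M := by
  have hc : Continuous fun r => deriv cutoff r * r :=
    (contDiff_cutoff.continuous_deriv (by simp)).mul continuous_id
  obtain ⟨M, hM⟩ := isCompact_Icc.exists_bound_of_continuousOn (s := Icc (0 : ℝ) 2) hc.continuousOn
  have hM0 : 0 ≤ M := (norm_nonneg _).trans (hM 0 (by simp))
  refine ⟨M, hM0, fun r hr => ?_⟩
  rcases le_or_gt r 2 with h | h
  · exact hM r ⟨hr, h⟩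
  · rw [deriv_cutoff_of_gt h]; simpa using hM0

/-- The truncations cutoff((k+1)·y(1-y))·g are test functions, and by dominated convergence they
tend weakly to g in H¹. Weak convergence is enough because the closed subspace `H10` equals its
double orthogonal complement. -/
theorem ofDeriv_mem_H10 {g : ℝ → ℝ} (hg : ContDiff ℝ ∞ g) {K : ℝ}
    (hK : ∀ y ∈ Ioo (0 : ℝ) 1, |g y| ≤ K * (y * (1 - y))) :
    H1.ofDeriv g (deriv g) (fun x => (hg.differentiable (by simp) x).hasDerivAt)
      (hg.continuous_deriv (by simp)) ∈ H10 := by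
  have hgd : Differentiable ℝ g := hg.differentiable (by simp)
  have hgc : Continuous (deriv g) := hg.continuous_deriv (by simp)
  have hcd : Differentiable ℝ cutoff := contDiff_cutoff.differentiable (by simp)
  have hcc : Continuous (deriv cutoff) := contDiff_cutoff.continuous_deriv (by simp)
  rw [← Submodule.orthogonal_orthogonal H10, Submodule.mem_orthogonal]
  intro w hw
  rw [Submodule.mem_orthogonal'] at hw
  let φ : ℕ → ℝ → ℝ := fun k y => cutoff ((k + 1) * (y * (1 - y))) * g y
  let φ' : ℕ → ℝ → ℝ := fun k y =>
    deriv cutoff ((k + 1) * (y * (1 - y))) * ((k + 1) * (1 - 2 * y)) * g y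
      + cutoff ((k + 1) * (y * (1 - y))) * deriv g y
  have hφ : ∀ k, IsTestFunction 0 1 (φ k) := by
    intro k
    have hsub : Function.support (φ k) ⊆ {y | 1 ≤ ((k : ℝ) + 1) * (y * (1 - y))} := by
      intro y hy
      by_contra hlt
      simp only [mem_ofPred_eq, not_le] at hlt
      exact hy (by simp only [φ]; rw [cutoff_of_le hlt.le, zero_mul])
    have hcl : IsClosed {y : ℝ | 1 ≤ ((k : ℝ) + 1) * (y * (1 - y))} :=
      isClosed_le continuous_const (by fun_prop)
    have hIoo : {y : ℝ | 1 ≤ ((k : ℝ) + 1) * (y * (1 - y))} ⊆ Ioo 0 1 := by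
      intro y hy
      have hk : (0 : ℝ) < k + 1 := by positivity
      have hpos : 0 < y * (1 - y) := by
        by_contra hneg
        have := mul_nonpos_of_nonneg_of_nonpos hk.le (not_lt.1 hneg)
        have h1 : 1 ≤ ((k : ℝ) + 1) * (y * (1 - y)) := hy
        linarith
      constructor <;> nlinarith [sq_nonneg y, sq_nonneg (1 - y)]
    refine ⟨?_, ?_, (closure_minimal hsub hcl).trans hIoo⟩
    · exact (contDiff_cutoff.comp (by fun_prop)).mul hg
    · exact HasCompactSupport.of_support_subset_isCompact isCompact_Icc
        ((hsub.trans hIoo).trans Ioo_subset_Icc_self)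
  have hφ' : ∀ k y, HasDerivAt (φ k) (φ' k y) y := by
    intro k y
    have h1 : HasDerivAt (fun y : ℝ => ((k : ℝ) + 1) * (y * (1 - y))) ((k + 1) * (1 - 2 * y)) y := by
      have := ((hasDerivAt_id y).mul ((hasDerivAt_const y (1 : ℝ)).sub (hasDerivAt_id y))).const_mul
        ((k : ℝ) + 1)
      refine this.congr_deriv ?_
      simp only [Pi.sub_apply, id]
      ring
    exact (((hcd _).hasDerivAt.comp y h1).mul (hgd y).hasDerivAt)
  have hφc : ∀ k, Continuous (φ' k) := fun k => by
    simp only [φ']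
    have := contDiff_cutoff.continuous
    have := hg.continuous
    fun_prop
  obtain ⟨M, hM0, hM⟩ := exists_bound_deriv_cutoff
  obtain ⟨A, hA⟩ := isCompact_Icc.exists_bound_of_continuousOn (s := Icc (0 : ℝ) 1)
    hg.continuous.continuousOn
  obtain ⟨B, hB⟩ := isCompact_Icc.exists_bound_of_continuousOn (s := Icc (0 : ℝ) 1)
    hgc.continuousOn
  have hev : ∀ y ∈ Ioo (0 : ℝ) 1, ∀ᶠ k : ℕ in atTop, 2 < ((k : ℝ) + 1) * (y * (1 - y)) := by
    intro y hy
    have hp : 0 < y * (1 - y) := mul_pos hy.1 (by linarith [hy.2])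
    exact ((tendsto_natCast_atTop_atTop.atTop_add tendsto_const_nhds).atTop_mul_const hp
      ).eventually_gt_atTop 2
  have hl1 := tendsto_integral_L2_mul w.toL2 (F := φ) (G := g) (C := A)
    (fun k => (hφ k).1.continuous)
    (fun k y hy => by
      simp only [φ]
      rw [abs_mul]
      calc _ ≤ 1 * |g y| := mul_le_mul_of_nonneg_right (abs_cutoff_le _) (abs_nonneg _)
        _ ≤ A := by rw [one_mul]; exact hA y (Ioo_subset_Icc_self hy))
    (fun y hy => tendsto_const_nhds.congr' (by
      filter_upwards [hev y hy] with k hk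
      simp only [φ]
      rw [cutoff_of_ge hk.le, one_mul]))
  have hl2 := tendsto_integral_L2_mul w.dy (F := φ') (G := deriv g) (C := M * |K| + B) hφc
    (fun k y hy => by
      have hp : 0 < y * (1 - y) := mul_pos hy.1 (by linarith [hy.2])
      have hk : (0 : ℝ) < k + 1 := by positivity
      refine (abs_add_le _ _).trans (add_le_add ?_ ?_)
      · have h1 : |1 - 2 * y| ≤ 1 := abs_le.2 ⟨by linarith [hy.2], by linarith [hy.1]⟩
        have h2 := hM _ (mul_pos hk hp).le
        have h3 : |g y| ≤ |K| * (y * (1 - y)) :=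
          (hK y hy).trans (mul_le_mul_of_nonneg_right (le_abs_self K) hp.le)
        rw [abs_mul, abs_of_pos (mul_pos hk hp)] at h2
        rw [abs_mul, abs_mul, abs_mul, abs_of_pos hk]
        set D := |deriv cutoff ((k + 1) * (y * (1 - y)))|
        have hD : 0 ≤ D := abs_nonneg _
        calc D * ((k + 1) * |1 - 2 * y|) * |g y|
            ≤ D * ((k + 1) * 1) * (|K| * (y * (1 - y))) := by gcongr
          _ = D * ((k + 1) * (y * (1 - y))) * |K| := by ring
          _ ≤ M * |K| := by gcongr
      · rw [abs_mul]
        calc _ ≤ 1 * |deriv g y| := mul_le_mul_of_nonneg_right (abs_cutoff_le _) (abs_nonneg _)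
          _ ≤ B := by rw [one_mul]; exact hB y (Ioo_subset_Icc_self hy))
    (fun y hy => tendsto_const_nhds.congr' (by
      filter_upwards [hev y hy] with k hk
      simp only [φ']
      rw [cutoff_of_ge hk.le, deriv_cutoff_of_gt hk]; ring))
  have hz : ∀ k, ∫ y, w.toL2 y * φ k y ∂vol01 + ∫ y, w.dy y * φ' k y ∂vol01 = 0 := by
    intro k
    have := hw _ (ofDeriv_test_mem_H10 (hφ k))
    rw [H1.inner_ofDeriv] at this
    rw [← this]
    congr 2
    ext y
    rw [(hφ' k y).deriv]
  rw [H1.inner_ofDeriv]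
  have hl := hl1.add hl2
  simp only [hz] at hl
  exact tendsto_nhds_unique hl tendsto_const_nhds

/-! ### The sine functions and their orthonormality -/

/-- The frequencies `(n + 1) π`. -/
def freq (n : ℕ) : ℝ := (n + 1) * Real.pi

theorem freq_pos (n : ℕ) : 0 < freq n := by unfold freq; positivity

theorem three_lt_freq (n : ℕ) : 3 < freq n := by
  have := Real.pi_gt_three
  unfold freq
  nlinarith [(Nat.cast_nonneg n : (0 : ℝ) ≤ n)]

theorem sin_freq (n : ℕ) : Real.sin (freq n) = 0 := by
  have := Real.sin_nat_mul_pi (n + 1)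
  push_cast at this
  exact this

theorem hasDerivAt_sin_mul (s y : ℝ) :
    HasDerivAt (fun y => Real.sin (s * y)) (s * Real.cos (s * y)) y := by
  have := (Real.hasDerivAt_sin (s * y)).comp y ((hasDerivAt_id y).const_mul s)
  exact this.congr_deriv (by ring)

theorem hasDerivAt_cos_mul (s y : ℝ) :
    HasDerivAt (fun y => Real.cos (s * y)) (-(s * Real.sin (s * y))) y := by
  have := (Real.hasDerivAt_cos (s * y)).comp y ((hasDerivAt_id y).const_mul s)
  exact this.congr_deriv (by ring)

/-- The function `√2 sin((n + 1) π y)` as an element of `H¹(0,1)`. -/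
def sineH1 (n : ℕ) : H1 :=
  H1.ofDeriv (fun y => √2 * Real.sin (freq n * y)) (fun y => √2 * (freq n * Real.cos (freq n * y)))
    (fun y => (hasDerivAt_sin_mul _ y).const_mul _) (by fun_prop)

/-- The function `√2 sin((n + 1) π y)` as an element of `L²(0,1)`. -/
def sine (n : ℕ) : L2 := (sineH1 n).toL2

theorem inner_sine (f : L2) (n : ℕ) :
    inner ℝ f (sine n) = ∫ y, f y * (√2 * Real.sin (freq n * y)) ∂vol01 :=
  inner_ofCont f (fun y => √2 * Real.sin (freq n * y)) (by fun_prop)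

theorem sineH1_mem (n : ℕ) : sineH1 n ∈ H10 := by
  have h := ofDeriv_mem_H10 (g := fun y => √2 * Real.sin (freq n * y)) (K := √2 * (2 * freq n))
    (contDiff_const.mul (Real.contDiff_sin.comp (contDiff_const.mul contDiff_id))) (by
      intro y hy
      have hf := freq_pos n
      rw [abs_mul, abs_of_pos (by positivity : (0 : ℝ) < √2), mul_assoc]
      refine mul_le_mul_of_nonneg_left ?_ (by positivity)
      have h1 : |Real.sin (freq n * y)| ≤ freq n * y := by
        refine (Real.abs_sin_le_abs).trans ?_
        rw [abs_of_nonneg (mul_nonneg hf.le hy.1.le)]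
      have h2 : |Real.sin (freq n * y)| ≤ freq n * (1 - y) := by
        have : |Real.sin (freq n * y)| = |Real.sin (freq n * (1 - y))| := by
          have hc : |Real.cos (freq n)| = 1 := by
            have := Real.sin_sq_add_cos_sq (freq n)
            rw [sin_freq] at this
            have h3 : |Real.cos (freq n)| ^ 2 = 1 := by rw [sq_abs]; linarith
            nlinarith [abs_nonneg (Real.cos (freq n))]
          rw [mul_sub, mul_one, Real.sin_sub, sin_freq, zero_mul, zero_sub, abs_neg, abs_mul, hc,
            one_mul]
        rw [this]
        refine (Real.abs_sin_le_abs).trans ?_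
        rw [abs_of_nonneg (mul_nonneg hf.le (by linarith [hy.2]))]
      -- The bound from the nearer endpoint is used; the other factor is at least 1/2, whence the 2
      -- in `K`.
      rcases le_total y (1 / 2) with hy2 | hy2
      · refine h1.trans ?_
        have : y ≤ 2 * (y * (1 - y)) := by nlinarith [hy.1]
        nlinarith
      · refine h2.trans ?_
        have : 1 - y ≤ 2 * (y * (1 - y)) := by nlinarith [hy.2]
        nlinarith)
  have he : ∀ v ∈ H10, v.toL2 = sine n → sineH1 n ∈ H10 := fun v hv hvs =>
    (H1.ext_toL2 (w := sineH1 n) hvs) ▸ hv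
  exact he _ h rfl

/-- The eigenvalue relation for the sine functions. -/
theorem inner_sineH1 {v : H1} (hv : v ∈ H10) (n : ℕ) :
    inner ℝ v (sineH1 n) = (1 + freq n ^ 2) * inner ℝ v.toL2 (sine n) := by
  have h := inner_dy_of_mem_H10 hv (h := fun y => √2 * (freq n * Real.cos (freq n * y)))
    (k := fun y => √2 * (freq n * -(freq n * Real.sin (freq n * y))))
    (fun y => ((hasDerivAt_cos_mul _ y).const_mul _).const_mul _) (by fun_prop)
  rw [inner_H1]
  have h2 : inner ℝ v.dy (sineH1 n).dy = freq n ^ 2 * inner ℝ v.toL2 (sine n) := by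
    refine h.trans ?_
    rw [inner_ofCont, inner_sine, ← integral_const_mul, ← integral_neg]
    congr 1
    ext y
    ring
  rw [h2]
  change inner ℝ v.toL2 (sine n) + _ = _
  ring

theorem inner_sine_self (n : ℕ) : inner ℝ (sine n) (sine n) = 1 := by
  have hf := (freq_pos n).ne'
  have h0 : inner ℝ (sine n) (sine n)
      = ∫ y, (√2 * Real.sin (freq n * y)) * (√2 * Real.sin (freq n * y)) ∂vol01 := by
    rw [inner_sine]
    refine integral_congr_ae ?_
    filter_upwards [coeFn_ofCont (fun y => √2 * Real.sin (freq n * y)) (by fun_prop)] with y hy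
    exact congrArg (· * (√2 * Real.sin (freq n * y))) hy
  rw [h0, ← integral_Ioc_eq_integral_Ioo, ← intervalIntegral.integral_of_le zero_le_one,
    intervalIntegral.integral_eq_sub_of_hasDerivAt
      -- The derivative is 1 - cos² + sin² = 2 sin².
      (f := fun y => y - Real.sin (freq n * y) * Real.cos (freq n * y) / freq n)]
  · simp [sin_freq]
  · intro y _
    have := (hasDerivAt_id y).sub (((hasDerivAt_sin_mul (freq n) y).mul
      (hasDerivAt_cos_mul (freq n) y)).div_const (freq n))
    refine this.congr_deriv ?_
    have h2 : √2 * √2 = (2 : ℝ) := Real.mul_self_sqrt (by norm_num)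
    have h1 := Real.sin_sq_add_cos_sq (freq n * y)
    field_simp
    linear_combination (-Real.sin (freq n * y) ^ 2) * h2 - h1
  · exact Continuous.intervalIntegrable (by fun_prop) _ _

theorem inner_sineH1_sineH1 (n m : ℕ) :
    inner ℝ (sineH1 n) (sineH1 m) = (1 + freq m ^ 2) * inner ℝ (sine n) (sine m) :=
  inner_sineH1 (sineH1_mem n) m

/-- Eigenfunctions of a symmetric form with distinct eigenvalues are orthogonal: evaluating the H¹
inner product in both orders gives (ω_m² - ω_n²)⟨e_n,e_m⟩ = 0. -/
theorem orthonormal_sine : Orthonormal ℝ sine := by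
  rw [orthonormal_iff_ite]
  intro n m
  split_ifs with h
  · rw [h, inner_sine_self]
  · have h1 := inner_sineH1_sineH1 n m
    have h2 := inner_sineH1_sineH1 m n
    rw [real_inner_comm, h1, real_inner_comm (sine n)] at h2
    have h3 : (freq m ^ 2 - freq n ^ 2) * inner ℝ (sine n) (sine m) = 0 := by linarith
    rcases mul_eq_zero.1 h3 with h4 | h4
    · exfalso
      have h5 : freq m = freq n :=
        (sq_eq_sq₀ (freq_pos m).le (freq_pos n).le).1 (sub_eq_zero.1 h4)
      simp only [freq, mul_eq_mul_right_iff, add_left_inj, Nat.cast_inj, Real.pi_ne_zero,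
        or_false] at h5
      exact h h5.symm
    · exact h4

/-! ### Completeness of the sine system -/

section
variable {f : L2} (hf : ∀ n, inner ℝ f (sine n) = 0)
include hf

theorem integral_mul_sin_eq_zero (n : ℕ) :
    ∫ y, f y * Real.sin (n * Real.pi * y) ∂vol01 = 0 := by
  cases n with
  | zero => simp
  | succ n =>
    have h := hf n
    rw [inner_sine] at h
    have h2 : ∫ y, f y * (√2 * Real.sin (freq n * y)) ∂vol01
        = √2 * ∫ y, f y * Real.sin ((n + 1 : ℕ) * Real.pi * y) ∂vol01 := by
      rw [← integral_const_mul]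
      congr 1; ext y
      simp only [freq]; push_cast; ring
    rw [h2] at h
    exact (mul_eq_zero.1 h).resolve_left (by positivity)

/-- The identity 2 sin((n+1)θ) cos θ = sin((n+2)θ) + sin(nθ) lowers the power of the cosine, at the
price of needing all n in the induction. -/
theorem integral_mul_sin_mul_cos_pow_eq_zero (k n : ℕ) :
    ∫ y, f y * (Real.sin (n * Real.pi * y) * Real.cos (Real.pi * y) ^ k) ∂vol01 = 0 := by
  induction k generalizing n with
  | zero => simpa using integral_mul_sin_eq_zero hf n
  | succ k ih =>
    cases n with
    | zero => simp
    | succ n =>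
      have key : ∀ y, f y * (Real.sin ((n + 1 : ℕ) * Real.pi * y) * Real.cos (Real.pi * y) ^ (k + 1))
          = (1 / 2) * (f y * (Real.sin ((n + 2 : ℕ) * Real.pi * y) * Real.cos (Real.pi * y) ^ k))
          + (1 / 2) * (f y * (Real.sin (n * Real.pi * y) * Real.cos (Real.pi * y) ^ k)) := by
        intro y
        have e1 : ((n + 2 : ℕ) : ℝ) * Real.pi * y
            = ((n + 1 : ℕ) : ℝ) * Real.pi * y + Real.pi * y := by push_cast; ring
        have e2 : (n : ℝ) * Real.pi * y
            = ((n + 1 : ℕ) : ℝ) * Real.pi * y - Real.pi * y := by push_cast; ring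
        rw [e1, e2, Real.sin_add, Real.sin_sub]
        ring
      have hint : ∀ m : ℕ, Integrable (fun y => (1 / 2 : ℝ) *
          (f y * (Real.sin (m * Real.pi * y) * Real.cos (Real.pi * y) ^ k))) vol01 := fun m =>
        (MemLp.integrable_mul (p := 2) (q := 2) (Lp.memLp f)
          (memLp_of_continuous (by fun_prop))).const_mul _
      simp_rw [key]
      rw [integral_add (hint _) (hint _), integral_const_mul, integral_const_mul, ih, ih]
      simp

theorem integral_mul_sin_mul_polynomial_eq_zero (p : Polynomial ℝ) :
    ∫ y, f y * (Real.sin (Real.pi * y) * p.eval (Real.cos (Real.pi * y))) ∂vol01 = 0 := by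
  induction p using Polynomial.induction_on' with
  | add p q hp hq =>
    have hint : ∀ p : Polynomial ℝ, Integrable (fun y =>
        f y * (Real.sin (Real.pi * y) * p.eval (Real.cos (Real.pi * y)))) vol01 := fun p =>
      MemLp.integrable_mul (p := 2) (q := 2) (Lp.memLp f)
        (memLp_of_continuous (by fun_prop))
    simp_rw [Polynomial.eval_add, mul_add]
    rw [integral_add (hint p) (hint q), hp, hq, add_zero]
  | monomial k a =>
    have h := integral_mul_sin_mul_cos_pow_eq_zero hf k 1
    simp only [Polynomial.eval_monomial]
    rw [← mul_zero a, ← h, ← integral_const_mul]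
    congr 1; ext y
    simp only [Nat.cast_one, one_mul]
    ring

/-- On (0,1) a test function φ is a continuous function of cos(πy), so Weierstrass approximates it
uniformly by p(cos(πy)). Since f·sin(πy) integrates to zero against every such polynomial, it
vanishes a.e., and sin(πy) > 0 on (0,1). -/
theorem eq_zero_of_inner_sine_eq_zero : f = 0 := by
  have hfi := integrable_L2 f
  have hi : ∀ g : ℝ → ℝ, Continuous g → Integrable (fun y => f y * g y) vol01 := fun g hg =>
    MemLp.integrable_mul (p := 2) (q := 2) (Lp.memLp f) (memLp_of_continuous hg)
  have h0 : (fun y => f y * Real.sin (Real.pi * y)) =ᵐ[vol01] 0 := by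
    refine ae_eq_zero_of_test (hi _ (by fun_prop)) fun φ hφ => ?_
    have hφc := hφ.1.continuous
    have hbd : ∀ ε > 0, |∫ y in Ioo (0 : ℝ) 1, f y * Real.sin (Real.pi * y) * φ y|
        ≤ (∫ y, |f y| ∂vol01) * ε := by
      intro ε hε
      obtain ⟨p, hp⟩ := exists_polynomial_near_of_continuousOn (-1) 1
        (fun t => φ (Real.arccos t / Real.pi))
        (hφc.comp (Real.continuous_arccos.div_const _)).continuousOn ε hε
      have hpc : Continuous fun y => Real.sin (Real.pi * y) *
          (φ y - p.eval (Real.cos (Real.pi * y))) := by fun_prop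
      have he : ∫ y in Ioo (0 : ℝ) 1, f y * Real.sin (Real.pi * y) * φ y
          = ∫ y, f y * (Real.sin (Real.pi * y) * (φ y - p.eval (Real.cos (Real.pi * y)))) ∂vol01 := by
        have h1 := integral_mul_sin_mul_polynomial_eq_zero hf p
        refine (sub_zero _).symm.trans ((congrArg (_ - ·) h1.symm).trans ?_)
        rw [← integral_sub]
        · congr 1; ext y; ring
        · simp_rw [mul_assoc]
          exact hi (fun y => Real.sin (Real.pi * y) * φ y) (by fun_prop)
        · exact hi _ (by fun_prop)
      rw [he, ← integral_mul_const, ← Real.norm_eq_abs]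
      refine norm_integral_le_of_norm_le (hfi.norm.mul_const ε) ?_
      filter_upwards [ae_restrict_mem measurableSet_Ioo] with y hy
      rw [norm_mul, norm_mul]
      refine mul_le_mul_of_nonneg_left ?_ (norm_nonneg _)
      have h1 : |Real.sin (Real.pi * y)| ≤ 1 := Real.abs_sin_le_one _
      have h2 := hp (Real.cos (Real.pi * y)) (Real.cos_mem_Icc _)
      rw [Real.arccos_cos (mul_nonneg Real.pi_pos.le hy.1.le)
        (by nlinarith [Real.pi_pos, hy.2]), mul_div_cancel_left₀ _ Real.pi_ne_zero,
        abs_sub_comm] at h2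
      calc _ ≤ 1 * ε := mul_le_mul h1 h2.le (abs_nonneg _) zero_le_one
        _ = ε := one_mul _
    have hle : |∫ y in Ioo (0 : ℝ) 1, f y * Real.sin (Real.pi * y) * φ y| ≤ 0 := by
      have ht : Tendsto (fun ε : ℝ => (∫ y, |f y| ∂vol01) * ε) (𝓝[>] 0) (𝓝 0) := by
        have : Tendsto (fun ε : ℝ => (∫ y, |f y| ∂vol01) * ε) (𝓝 0)
            (𝓝 ((∫ y, |f y| ∂vol01) * 0)) := tendsto_id.const_mul _
        rw [mul_zero] at this
        exact this.mono_left nhdsWithin_le_nhds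
      exact ge_of_tendsto ht (by filter_upwards [self_mem_nhdsWithin] with ε hε using hbd ε hε)
    exact abs_eq_zero.1 (le_antisymm hle (abs_nonneg _))
  rw [Lp.eq_zero_iff_ae_eq_zero]
  filter_upwards [h0, ae_restrict_mem measurableSet_Ioo] with y hy hy2
  refine (mul_eq_zero.1 hy).resolve_right (Real.sin_pos_of_pos_of_lt_pi ?_ ?_).ne'
  · exact mul_pos Real.pi_pos hy2.1
  · nlinarith [Real.pi_pos, hy2.2]

end

/-- The sine basis of `L²(0,1)`. -/
def sineBasis : HilbertBasis ℕ ℝ L2 :=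
  HilbertBasis.mkOfOrthogonalEqBot orthonormal_sine (by
    rw [Submodule.eq_bot_iff]
    intro f hf
    refine eq_zero_of_inner_sine_eq_zero fun n => ?_
    exact (Submodule.mem_orthogonal' _ _).1 hf _ (Submodule.subset_span ⟨n, rfl⟩))

@[simp] theorem coe_sineBasis : ⇑sineBasis = sine := HilbertBasis.coe_mkOfOrthogonalEqBot _ _

/-- The `H¹` norm of the sine functions. -/
def sineNorm (n : ℕ) : ℝ := √(1 + freq n ^ 2)

theorem sineNorm_pos (n : ℕ) : 0 < sineNorm n := by unfold sineNorm; positivity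

theorem sineNorm_sq (n : ℕ) : sineNorm n ^ 2 = 1 + freq n ^ 2 := Real.sq_sqrt (by positivity)

/-- The sine functions, normalized in `H¹₀(0,1)`. -/
def sineH10 (n : ℕ) : H10 := (sineNorm n)⁻¹ • ⟨sineH1 n, sineH1_mem n⟩

theorem inner_sineH10 (v : H10) (n : ℕ) :
    inner ℝ (sineH10 n) v = sineNorm n * inner ℝ (sine n) (v : H1).toL2 := by
  have h := inner_sineH1 v.2 n
  have hs := sineNorm_sq n
  have hp := (sineNorm_pos n).ne'
  rw [sineH10, Submodule.coe_inner, Submodule.coe_smul,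
    real_inner_smul_left, real_inner_comm, h, real_inner_comm,
    ← hs]
  field_simp

theorem toL2_sineH10 (n : ℕ) : (sineH10 n : H1).toL2 = (sineNorm n)⁻¹ • sine n := by
  rw [← toL2L_apply, sineH10, Submodule.coe_smul, map_smul]
  rfl

theorem orthonormal_sineH10 : Orthonormal ℝ sineH10 := by
  rw [orthonormal_iff_ite]
  intro n m
  rw [inner_sineH10, toL2_sineH10, real_inner_smul_right,
    orthonormal_iff_ite.1 orthonormal_sine n m]
  have hp := (sineNorm_pos n).ne'
  split_ifs with h
  · rw [← h]; field_simp
  · simp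

/-- The sine basis of `H¹₀(0,1)`. -/
def sineH10Basis : HilbertBasis ℕ ℝ H10 :=
  HilbertBasis.mkOfOrthogonalEqBot orthonormal_sineH10 (by
    rw [Submodule.eq_bot_iff]
    intro v hv
    have h0 : (v : H1).toL2 = 0 := eq_zero_of_inner_sine_eq_zero fun n => by
      have := (Submodule.mem_orthogonal _ _).1 hv _ (Submodule.subset_span ⟨n, rfl⟩)
      rw [inner_sineH10] at this
      rw [real_inner_comm]
      exact (mul_eq_zero.1 this).resolve_left (sineNorm_pos n).ne'
    exact Subtype.ext (H1.ext_toL2 h0))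

@[simp] theorem coe_sineH10Basis : ⇑sineH10Basis = sineH10 :=
  HilbertBasis.coe_mkOfOrthogonalEqBot _ _

theorem sineH10Basis_repr (v : H10) (n : ℕ) :
    sineH10Basis.repr v n = sineNorm n * sineBasis.repr (v : H1).toL2 n := by
  rw [HilbertBasis.repr_apply_apply, HilbertBasis.repr_apply_apply, coe_sineH10Basis,
    coe_sineBasis, inner_sineH10]

/-! ### Coordinatewise maps on ℓ², the phase space and its rotation group -/

section lpMap
variable {E F : Type*} [NormedAddCommGroup E] [NormedSpace ℝ E] [NormedAddCommGroup F]
  [NormedSpace ℝ F]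

/-- A uniformly bounded sequence of linear maps, acting coordinatewise on `ℓ²`. -/
def lpMap (T : ℕ → E →ₗ[ℝ] F) (C : ℝ) (hT : ∀ n z, ‖T n z‖ ≤ C * ‖z‖) :
    lp (fun _ : ℕ => E) 2 →L[ℝ] lp (fun _ : ℕ => F) 2 :=
  have hT' : ∀ n z, ‖T n z‖ ≤ ‖C • z‖ := fun n z => (hT n z).trans (by
    rw [norm_smul]
    exact mul_le_mul_of_nonneg_right (Real.le_norm_self C) (norm_nonneg _))
  LinearMap.mkContinuous
    { toFun := fun z => ⟨fun n => T n (z n),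
        (lp.memℓp (C • z)).norm.mono fun n => hT' n (z n)⟩
      map_add' := fun z w => lp.ext (funext fun n => (T n).map_add (z n) (w n))
      map_smul' := fun c z => lp.ext (funext fun n => (T n).map_smul c (z n)) } ‖C‖ (by
    intro z
    rw [← norm_smul]
    exact lp.norm_mono (by norm_num) fun n => hT' n (z n))

variable (T : ℕ → E →ₗ[ℝ] F) {C : ℝ} (hT : ∀ n z, ‖T n z‖ ≤ C * ‖z‖)

@[simp] theorem lpMap_apply (z : lp (fun _ : ℕ => E) 2) (n : ℕ) :
    lpMap T C hT z n = T n (z n) := rfl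

theorem norm_lpMap_le (hC : 0 ≤ C) (z : lp (fun _ : ℕ => E) 2) : ‖lpMap T C hT z‖ ≤ C * ‖z‖ := by
  have h : ‖lpMap T C hT z‖ ≤ ‖C • z‖ := lp.norm_mono (by norm_num) fun n => (hT n (z n)).trans (by
    rw [lp.coeFn_smul, Pi.smul_apply, norm_smul, Real.norm_of_nonneg hC])
  rwa [norm_smul, Real.norm_of_nonneg hC] at h

end lpMap

/-- The phase space: the state `(u, u_x)` has coordinates `ω_n ⟨e_n, u⟩ + i ⟨e_n, u_x⟩`. -/
abbrev Phase : Type := lp (fun _ : ℕ => ℂ) 2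

theorem norm_mulLeft_exp_le (t : ℝ) (n : ℕ) (z : ℂ) :
    ‖LinearMap.mulLeft ℝ (Complex.exp ((freq n * t : ℝ) * Complex.I)) z‖ ≤ 1 * ‖z‖ := by
  rw [LinearMap.mulLeft_apply, norm_mul, Complex.norm_exp_ofReal_mul_I]

/-- The rotation `z_n ↦ exp(i ω_n t) z_n` of the phase space. -/
def rot (t : ℝ) : Phase →L[ℝ] Phase :=
  lpMap (fun n => LinearMap.mulLeft ℝ (Complex.exp ((freq n * t : ℝ) * Complex.I))) 1
    (norm_mulLeft_exp_le t)

theorem rot_apply (t : ℝ) (z : Phase) (n : ℕ) :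
    rot t z n = Complex.exp ((freq n * t : ℝ) * Complex.I) * z n := rfl

theorem rot_rot (s t : ℝ) (z : Phase) : rot s (rot t z) = rot (s + t) z := by
  refine lp.ext (funext fun n => ?_)
  rw [rot_apply, rot_apply, rot_apply, ← mul_assoc, ← Complex.exp_add]
  congr 2
  push_cast; ring

theorem rot_zero (z : Phase) : rot 0 z = z := by
  refine lp.ext (funext fun n => ?_)
  rw [rot_apply]; simp

/-- The rotation and its inverse are both contractions. -/
theorem norm_rot (t : ℝ) (z : Phase) : ‖rot t z‖ = ‖z‖ := by
  have h : ∀ s w, ‖rot s w‖ ≤ ‖w‖ := fun s w => by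
    rw [← one_mul ‖w‖]
    exact norm_lpMap_le _ (norm_mulLeft_exp_le s) zero_le_one w
  refine le_antisymm (h t z) ?_
  have := h (-t) (rot t z)
  rwa [rot_rot, neg_add_cancel, rot_zero] at this

attribute [irreducible] rot

/-- The frequencies are unbounded, so only strong continuity is available: the orbit is a uniform
limit in t of orbits of finite truncations, uniform because the rotations are isometries. -/
theorem continuous_rot_left (z : Phase) : Continuous fun t => rot t z := by
  have hs := lp.hasSum_single (by norm_num) z
  have hu : TendstoUniformly (fun (s : Finset ℕ) t => rot t (∑ i ∈ s, lp.single 2 i (z i)))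
      (fun t => rot t z) atTop := by
    rw [Metric.tendstoUniformly_iff]
    intro ε hε
    filter_upwards [(Metric.tendsto_nhds.1 hs) ε hε] with s hs t
    rw [dist_eq_norm, ← map_sub, norm_rot, ← dist_eq_norm, dist_comm]
    exact hs
  refine hu.continuous (Frequently.of_forall fun s => ?_)
  have hsingle : ∀ t i, rot t (lp.single 2 i (z i))
      = lp.single 2 i (Complex.exp ((freq i * t : ℝ) * Complex.I) * z i) := by
    intro t i
    refine lp.ext (funext fun n => ?_)
    rw [rot_apply]
    rcases eq_or_ne n i with rfl | h
    · simp
    · rw [lp.single_apply_ne _ _ _ h, lp.single_apply_ne _ _ _ h, mul_zero]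
  simp only [map_sum, hsingle]
  refine continuous_finsetSum _ fun i _ => ?_
  exact (lp.isometry_single (p := 2) i).continuous.comp (by fun_prop)

theorem continuous_rot : Continuous fun p : ℝ × Phase => rot p.1 p.2 := by
  refine continuous_iff_continuousAt.2 fun p => ?_
  rw [ContinuousAt, tendsto_iff_norm_sub_tendsto_zero]
  have h1 : Tendsto (fun q : ℝ × Phase => ‖q.2 - p.2‖ + ‖rot q.1 p.2 - rot p.1 p.2‖) (𝓝 p)
      (𝓝 0) := by
    have hc : Continuous fun q : ℝ × Phase => ‖q.2 - p.2‖ + ‖rot q.1 p.2 - rot p.1 p.2‖ := by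
      have := (continuous_rot_left p.2).comp (continuous_fst (X := ℝ) (Y := Phase))
      exact (continuous_snd.sub continuous_const).norm.add (this.sub continuous_const).norm
    simpa using hc.tendsto p
  refine squeeze_zero (fun _ => norm_nonneg _) (fun q => ?_) h1
  calc ‖rot q.1 q.2 - rot p.1 p.2‖
      = ‖rot q.1 (q.2 - p.2) + (rot q.1 p.2 - rot p.1 p.2)‖ := by rw [map_sub]; congr 1; abel
    _ ≤ _ := (norm_add_le _ _).trans (by rw [norm_rot])

theorem continuous_rot_comp {f : ℝ → ℝ} {g : ℝ → Phase} (hf : Continuous f) (hg : Continuous g) :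
    Continuous fun x => rot (f x) (g x) :=
  continuous_rot.comp (hf.prodMk hg)

/-- This is the Poincaré inequality: ω > 3 gives 1 + ω² ≤ 1.21 ω². The sharpness matters, since the
sum 1 + 11/10 must stay below the √(2e) ≈ 2.33 allowed by `le_eta`. -/
theorem sineNorm_div_freq_le (n : ℕ) : sineNorm n / freq n ≤ 11 / 10 := by
  have h := three_lt_freq n
  rw [div_le_iff₀ (freq_pos n)]
  refine Real.sqrt_le_iff.2 ⟨by linarith, by nlinarith⟩

theorem norm_smul_re_le (n : ℕ) (z : ℂ) :
    ‖((sineNorm n / freq n) • Complex.reLm) z‖ ≤ 11 / 10 * ‖z‖ := by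
  rw [LinearMap.smul_apply, norm_smul,
    Real.norm_of_nonneg (div_pos (sineNorm_pos n) (freq_pos n)).le]
  exact mul_le_mul (sineNorm_div_freq_le n) (Complex.abs_re_le_norm z) (abs_nonneg _) (by norm_num)

theorem norm_im_le (_ : ℕ) (z : ℂ) : ‖Complex.imLm z‖ ≤ 1 * ‖z‖ := by
  rw [one_mul]; exact Complex.abs_im_le_norm z

theorem norm_I_mul_ofReal_le (_ : ℕ) (r : ℝ) :
    ‖(LinearMap.mulLeft ℝ Complex.I).comp Complex.ofRealAm.toLinearMap r‖ ≤ 1 * ‖r‖ := by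
  simp

theorem norm_smul_ofReal_le (n : ℕ) (r : ℝ) :
    ‖((freq n / sineNorm n) • Complex.ofRealAm.toLinearMap) r‖ ≤ 1 * ‖r‖ := by
  have h : freq n / sineNorm n ≤ 1 := by
    rw [div_le_one (sineNorm_pos n)]
    exact Real.le_sqrt_of_sq_le (by linarith)
  rw [LinearMap.smul_apply, norm_smul,
    Real.norm_of_nonneg (div_pos (freq_pos n) (sineNorm_pos n)).le]
  refine (mul_le_mul_of_nonneg_right h (norm_nonneg _)).trans ?_
  simp

/-- The position `u ∈ H¹₀(0,1)` of a state. -/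
def position : Phase →L[ℝ] H10 :=
  (sineH10Basis.repr.symm.toContinuousLinearEquiv : _ →L[ℝ] H10).comp
    (lpMap (fun n => (sineNorm n / freq n) • Complex.reLm) (11 / 10) norm_smul_re_le)

/-- The velocity `u_x ∈ L²(0,1)` of a state. -/
def velocity : Phase →L[ℝ] L2 :=
  (sineBasis.repr.symm.toContinuousLinearEquiv : _ →L[ℝ] L2).comp
    (lpMap (fun _ => Complex.imLm) 1 norm_im_le)

/-- The state with position `0` and a given velocity. -/
def ofVelocity : L2 →L[ℝ] Phase :=
  (lpMap (fun _ => (LinearMap.mulLeft ℝ Complex.I).comp Complex.ofRealAm.toLinearMap) 1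
    norm_I_mul_ofReal_le).comp (sineBasis.repr.toContinuousLinearEquiv : L2 →L[ℝ] _)

/-- The state with velocity `0` and a given position. -/
def ofPosition : H10 →L[ℝ] Phase :=
  (lpMap (fun n => (freq n / sineNorm n) • Complex.ofRealAm.toLinearMap) 1
    norm_smul_ofReal_le).comp (sineH10Basis.repr.toContinuousLinearEquiv : H10 →L[ℝ] _)

theorem repr_position (z : Phase) (n : ℕ) :
    sineBasis.repr (position z : H1).toL2 n = (z n).re / freq n := by
  have h := sineH10Basis_repr (position z) n
  have h2 : sineH10Basis.repr (position z) n = (sineNorm n / freq n) * (z n).re := by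
    have h1 : sineH10Basis.repr (position z) = lpMap _ _ norm_smul_re_le z :=
      sineH10Basis.repr.apply_symm_apply _
    rw [h1]; rfl
  have h3 := (sineNorm_pos n).ne'
  have h4 := (freq_pos n).ne'
  rw [h2] at h
  field_simp at h ⊢
  linarith

theorem repr_velocity (z : Phase) (n : ℕ) : sineBasis.repr (velocity z) n = (z n).im := by
  have h : sineBasis.repr (velocity z) = lpMap _ _ norm_im_le z :=
    sineBasis.repr.apply_symm_apply _
  rw [h]; rfl

theorem ofVelocity_apply (f : L2) (n : ℕ) :
    ofVelocity f n = Complex.I * (sineBasis.repr f n : ℝ) := rfl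

theorem ofPosition_apply (v : H10) (n : ℕ) :
    ofPosition v n = (freq n * sineBasis.repr (v : H1).toL2 n : ℝ) := by
  have h3 := (sineNorm_pos n).ne'
  have h : ofPosition v n = (freq n / sineNorm n * sineH10Basis.repr v n : ℝ) := by
    simp [ofPosition]
  rw [h, sineH10Basis_repr]
  congr 1
  field_simp

theorem norm_position_le (z : Phase) : ‖position z‖ ≤ 11 / 10 * ‖z‖ := by
  refine le_trans (le_of_eq ?_) (norm_lpMap_le _ norm_smul_re_le (by norm_num) z)
  exact sineH10Basis.repr.symm.norm_map _

theorem norm_velocity_le (z : Phase) : ‖velocity z‖ ≤ ‖z‖ := by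
  rw [← one_mul ‖z‖]
  refine le_trans (le_of_eq ?_) (norm_lpMap_le _ norm_im_le zero_le_one z)
  exact sineBasis.repr.symm.norm_map _

theorem norm_ofVelocity_le (f : L2) : ‖ofVelocity f‖ ≤ ‖f‖ := by
  rw [← one_mul ‖f‖, ← sineBasis.repr.norm_map f]
  exact norm_lpMap_le _ norm_I_mul_ofReal_le zero_le_one (sineBasis.repr f)

theorem ext_repr {f g : L2} (h : ∀ n, sineBasis.repr f n = sineBasis.repr g n) : f = g :=
  sineBasis.repr.injective (lp.ext (funext h))

theorem H1.ext_repr {v w : H1} (h : ∀ n, sineBasis.repr v.toL2 n = sineBasis.repr w.toL2 n) :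
    v = w :=
  H1.ext_toL2 (QuasiReversibility.ext_repr h)

theorem position_ofPosition (v : H10) : position (ofPosition v) = v := by
  refine Subtype.ext (H1.ext_repr fun n => ?_)
  rw [repr_position, ofPosition_apply, Complex.ofReal_re, mul_div_cancel_left₀ _ (freq_pos n).ne']

theorem velocity_ofPosition (v : H10) : velocity (ofPosition v) = 0 := by
  refine ext_repr fun n => ?_
  rw [repr_velocity, ofPosition_apply, Complex.ofReal_im]
  simp

/-! ### Duhamel's formula in the phase space -/

/-- Duhamel's formula for the wave equation with right-hand side `f`, in the phase space. -/
def duhamel (z₀ : Phase) (f : ℝ → L2) (x : ℝ) : Phase :=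
  rot (-x) (z₀ + ∫ s in (0 : ℝ)..x, rot s (ofVelocity (f s)))

section
variable {f : ℝ → L2} (hf : Continuous f) (z₀ : Phase)
include hf

theorem continuous_rot_ofVelocity : Continuous fun s => rot s (ofVelocity (f s)) :=
  continuous_rot_comp continuous_id (ofVelocity.continuous.comp hf)

theorem continuous_duhamel : Continuous (duhamel z₀ f) :=
  continuous_rot_comp continuous_neg (continuous_const.add
    (intervalIntegral.continuous_primitive
      (fun a b => (continuous_rot_ofVelocity hf).intervalIntegrable a b) 0))

theorem duhamel_apply (x : ℝ) (n : ℕ) : duhamel z₀ f x n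
    = Complex.exp ((freq n * (-x) : ℝ) * Complex.I) *
      (z₀ n + ∫ s in (0 : ℝ)..x, Complex.exp ((freq n * s : ℝ) * Complex.I) *
        (Complex.I * (sineBasis.repr (f s) n : ℝ))) := by
  rw [duhamel, rot_apply, lp.coeFn_add, Pi.add_apply]
  congr 2
  have := (lp.evalCLM ℝ (fun _ : ℕ => ℂ) 2 n).intervalIntegral_comp_comm
    ((continuous_rot_ofVelocity hf).intervalIntegrable (μ := volume) 0 x)
  refine this.symm.trans ?_
  congr 1
  ext s
  rw [← ofVelocity_apply, ← rot_apply]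
  rfl

theorem continuous_repr (n : ℕ) : Continuous fun s => sineBasis.repr (f s) n :=
  (lp.evalCLM ℝ (fun _ : ℕ => ℝ) 2 n).continuous.comp (sineBasis.repr.continuous.comp hf)

/-- With z_n = ω c + i d, the real and imaginary parts say c' = d and d' = -ω² c + f_n. -/
theorem hasDerivAt_duhamel_apply (x : ℝ) (n : ℕ) : HasDerivAt (fun x => duhamel z₀ f x n)
    (-(freq n * Complex.I) * duhamel z₀ f x n + Complex.I * (sineBasis.repr (f x) n : ℝ)) x := by
  have hr := continuous_repr hf n
  have h1 : HasDerivAt (fun x : ℝ => Complex.exp ((freq n * (-x) : ℝ) * Complex.I))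
      (Complex.exp ((freq n * (-x) : ℝ) * Complex.I) * (-(freq n * Complex.I))) x := by
    have h0 : HasDerivAt (fun x : ℝ => ((freq n * (-x) : ℝ) : ℂ) * Complex.I)
        (-(freq n * Complex.I)) x := by
      have := (((hasDerivAt_id x).neg.const_mul (freq n)).ofReal_comp).mul_const Complex.I
      exact this.congr_deriv (by push_cast; ring)
    exact h0.cexp
  have hc : Continuous fun s : ℝ => Complex.exp ((freq n * s : ℝ) * Complex.I) *
        (Complex.I * (sineBasis.repr (f s) n : ℝ)) := by fun_prop
  have h2 := (hc.integral_hasStrictDerivAt 0 x).hasDerivAt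
  have h3 := h1.mul (h2.const_add (z₀ n))
  have he : (fun x => duhamel z₀ f x n) = _ := funext fun x => duhamel_apply hf z₀ x n
  rw [he, duhamel_apply hf]
  refine h3.congr_deriv ?_
  have h4 : Complex.exp ((freq n * (-x) : ℝ) * Complex.I) *
      Complex.exp ((freq n * x : ℝ) * Complex.I) = 1 := by
    rw [← Complex.exp_add, ← Complex.exp_zero]
    congr 1
    push_cast; ring
  linear_combination (Complex.I * (sineBasis.repr (f x) n : ℝ)) * h4

/-- This is the energy estimate; both the outer and the inner rotation drop out as isometries. -/
theorem norm_duhamel_sub_le {g : ℝ → L2} (hg : Continuous g) {x : ℝ} (hx : 0 ≤ x) :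
    ‖duhamel z₀ f x - duhamel z₀ g x‖ ≤ ∫ s in (0 : ℝ)..x, ‖f s - g s‖ := by
  have h1 := (continuous_rot_ofVelocity hf).intervalIntegrable (μ := volume) 0 x
  have h2 := (continuous_rot_ofVelocity hg).intervalIntegrable (μ := volume) 0 x
  rw [duhamel, duhamel, ← map_sub, norm_rot, add_sub_add_left_eq_sub,
    ← intervalIntegral.integral_sub h1 h2]
  refine intervalIntegral.norm_integral_le_of_norm_le hx (ae_of_all _ fun s _ => ?_)
    ((hf.sub hg).norm.intervalIntegrable _ _)
  rw [← map_sub, ← map_sub, norm_rot]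
  exact norm_ofVelocity_le _

end

theorem duhamel_zero (z₀ : Phase) (f : ℝ → L2) : duhamel z₀ f 0 = z₀ := by
  rw [duhamel, intervalIntegral.integral_same, add_zero, neg_zero, rot_zero]

/-! ### The du Bois-Reymond lemma and classical derivatives from weak ones -/

theorem exists_Icc_of_isCompact {a b : ℝ} (hab : a < b) {K : Set ℝ} (hK : IsCompact K)
    (hKab : K ⊆ Ioo a b) : ∃ a' b', a < a' ∧ b' < b ∧ K ⊆ Icc a' b' := by
  rcases K.eq_empty_or_nonempty with rfl | hne
  -- For empty K the endpoints are reversed, so that the interval is empty.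
  · exact ⟨b, a, hab, hab, empty_subset _⟩
  · obtain ⟨p, hp, hp'⟩ := hK.exists_isLeast hne
    obtain ⟨q, hq, hq'⟩ := hK.exists_isGreatest hne
    exact ⟨p, q, (hKab hp).1, (hKab hq).2, fun x hx => ⟨hp' hx, hq' hx⟩⟩

/-- A test function with vanishing integral is the derivative of a test function. -/
theorem IsTestFunction.exists_primitive {a b : ℝ} (hab : a < b) {θ : ℝ → ℝ}
    (hθ : IsTestFunction a b θ) (h0 : ∫ x in Ioo a b, θ x = 0) :
    ∃ φ, IsTestFunction a b φ ∧ deriv φ = θ := by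
  have hc := hθ.1.continuous
  have hd : ∀ x, HasDerivAt (fun x => ∫ s in a..x, θ s) (θ x) x := fun x =>
    (hc.integral_hasStrictDerivAt a x).hasDerivAt
  have hderiv : deriv (fun x => ∫ s in a..x, θ s) = θ := funext fun x => (hd x).deriv
  obtain ⟨a', b', ha', hb', hK⟩ := exists_Icc_of_isCompact hab hθ.2.1 hθ.2.2
  have hz : ∀ x ∉ Icc a' b', θ x = 0 := fun x hx => image_eq_zero_of_notMem_tsupport fun h => hx (hK h)
  have hsupp : Function.support (fun x => ∫ s in a..x, θ s) ⊆ Icc a' b' := by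
    intro x hx
    by_contra hx'
    refine hx ?_
    rcases lt_or_ge x a' with h | h
    · refine intervalIntegral.integral_zero_ae (ae_of_all _ fun s hs => hz s fun hs' => ?_)
      have : s ≤ max a x := hs.2
      exact absurd (this.trans_lt (max_lt ha' h)) (not_lt.2 hs'.1)
    · have hbx : b' < x := by
        by_contra hle
        exact hx' ⟨h, not_lt.1 hle⟩
      have h1 : ∫ s in a..b, θ s = 0 := by
        rw [intervalIntegral.integral_of_le hab.le, integral_Ioc_eq_integral_Ioo, h0]
      have h2 : ∫ s in b..x, θ s = 0 := by
        refine intervalIntegral.integral_zero_ae (ae_of_all _ fun s hs => hz s fun hs' => ?_)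
        have : min b x < s := hs.1
        exact absurd ((lt_min hb' hbx).trans this) (not_lt.2 hs'.2)
      change ∫ s in a..x, θ s = 0
      rw [← intervalIntegral.integral_add_adjacent_intervals (hc.intervalIntegrable a b)
        (hc.intervalIntegrable b x), h1, h2, add_zero]
  refine ⟨_, ⟨?_, ?_, ?_⟩, hderiv⟩
  · rw [contDiff_infty_iff_deriv]
    exact ⟨fun x => (hd x).differentiableAt, by rw [hderiv]; exact hθ.1⟩
  · exact HasCompactSupport.of_support_subset_isCompact isCompact_Icc hsupp
  · exact (closure_minimal hsupp isClosed_Icc).trans fun x hx =>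
      ⟨ha'.trans_le hx.1, hx.2.trans_lt hb'⟩

theorem exists_test_integral_eq_one {a b : ℝ} (hab : a < b) :
    ∃ χ, IsTestFunction a b χ ∧ ∫ x in Ioo a b, χ x = 1 := by
  let B : ContDiffBump ((a + b) / 2) :=
    ⟨(b - a) / 8, (b - a) / 4, by linarith, by linarith⟩
  have hB : IsTestFunction a b (B.normed volume) := by
    refine ⟨B.contDiff_normed, B.hasCompactSupport_normed, ?_⟩
    rw [B.tsupport_normed_eq, Real.closedBall_eq_Icc]
    intro x hx
    have h1 : (a + b) / 2 - (b - a) / 4 ≤ x := hx.1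
    have h2 : x ≤ (a + b) / 2 + (b - a) / 4 := hx.2
    constructor <;> linarith
  refine ⟨_, hB, ?_⟩
  rw [setIntegral_eq_integral_of_forall_compl_eq_zero fun x hx => hB.eq_zero_of_notMem hx,
    B.integral_normed]

/-- The lemma of du Bois-Reymond for continuous functions. -/
theorem eqOn_const_of_integral_deriv_test {a b : ℝ} (hab : a < b) {G : ℝ → ℝ}
    (hG : ContinuousOn G (Icc a b))
    (h : ∀ φ, IsTestFunction a b φ → ∫ x in Ioo a b, deriv φ x * G x = 0) :
    ∃ c, EqOn G (fun _ => c) (Icc a b) := by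
  obtain ⟨χ, hχ, hχ1⟩ := exists_test_integral_eq_one hab
  have hGi : IntegrableOn G (Ioo a b) := hG.integrableOn_Icc.mono_set Ioo_subset_Icc_self
  have hmul : ∀ ψ : ℝ → ℝ, Continuous ψ → IntegrableOn (fun x => ψ x * G x) (Ioo a b) := fun ψ hψ =>
    ((hψ.continuousOn.mul hG).integrableOn_Icc).mono_set Ioo_subset_Icc_self
  have hcont : ∀ ψ : ℝ → ℝ, Continuous ψ → IntegrableOn ψ (Ioo a b) := fun ψ hψ =>
    (hψ.continuousOn.integrableOn_Icc).mono_set Ioo_subset_Icc_self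
  set c := ∫ x in Ioo a b, χ x * G x with hc
  refine ⟨c, ?_⟩
  have hae : (fun x => G x - c) =ᵐ[volume.restrict (Ioo a b)] 0 := by
    refine ae_eq_zero_of_test (hGi.sub (hcont _ continuous_const)) fun ψ hψ => ?_
    set m := ∫ x in Ioo a b, ψ x with hm
    -- Subtracting m·χ makes the mean zero, so the result is the derivative of a test function.
    have hθ : IsTestFunction a b (fun x => ψ x - m * χ x) := by
      refine ⟨hψ.1.sub (contDiff_const.mul hχ.1), hψ.2.1.sub (hχ.2.1.mul_left), ?_⟩
      refine (tsupport_sub _ _).trans (union_subset hψ.2.2 ?_)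
      exact (tsupport_mul_subset_right (f := fun _ => m)).trans hχ.2.2
    have hψi := hcont ψ hψ.1.continuous
    have hχi := hcont χ hχ.1.continuous
    obtain ⟨φ, hφ, hφ'⟩ := hθ.exists_primitive hab (by
      rw [integral_sub hψi (hχi.const_mul m), integral_const_mul, hχ1, ← hm]; ring)
    have h1 := h φ hφ
    rw [hφ'] at h1
    have hψG := hmul ψ hψ.1.continuous
    have hχG := hmul χ hχ.1.continuous
    have h2 : ∫ x in Ioo a b, (ψ x - m * χ x) * G x
        = (∫ x in Ioo a b, ψ x * G x) - m * c := by
      rw [hc, ← integral_const_mul, ← integral_sub hψG (hχG.const_mul m)]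
      congr 1; ext x; ring
    have h3 : ∫ x in Ioo a b, (G x - c) * ψ x = (∫ x in Ioo a b, ψ x * G x) - c * m := by
      rw [hm, ← integral_const_mul, ← integral_sub hψG (hψi.const_mul c)]
      congr 1; ext x; ring
    rw [h3]
    linarith
  refine Measure.eqOn_Icc_of_ae_eq volume hab.ne ?_ hG continuousOn_const
  rw [← restrict_Ioo_eq_restrict_Icc]
  filter_upwards [hae] with x hx
  exact sub_eq_zero.1 hx

/-- The function g minus a primitive of h has zero weak derivative, hence is constant. Extending h
constantly beyond [a,b] makes that primitive differentiable everywhere, endpoints included. -/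
theorem hasDerivWithinAt_of_weak {a b : ℝ} (hab : a < b) {g h : ℝ → ℝ}
    (hg : ContinuousOn g (Icc a b)) (hh : ContinuousOn h (Icc a b))
    (H : ∀ φ, IsTestFunction a b φ →
      ∫ x in Ioo a b, deriv φ x * g x = -∫ x in Ioo a b, φ x * h x) :
    ∀ x ∈ Icc a b, HasDerivWithinAt g (h x) (Icc a b) x := by
  set k : ℝ → ℝ := IccExtend hab.le ((Icc a b).domRestrict h) with hk
  have hkc : Continuous k := (continuousOn_iff_continuous_domRestrict.1 hh).Icc_extend'
  have hkh : ∀ x ∈ Icc a b, k x = h x := fun x hx => by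
    rw [hk, IccExtend_of_mem _ _ hx]; rfl
  have hd : ∀ x, HasDerivAt (fun x => ∫ s in a..x, k s) (k x) x := fun x =>
    (hkc.integral_hasStrictDerivAt a x).hasDerivAt
  have hdc : Continuous fun x => ∫ s in a..x, k s :=
    continuous_iff_continuousAt.2 fun x => (hd x).continuousAt
  obtain ⟨c, hc⟩ := eqOn_const_of_integral_deriv_test hab (hg.sub hdc.continuousOn)
    fun φ hφ => by
      have h1 := integral_deriv_test_mul hab.le hφ hd hkc
      have h2 : ∫ x in Ioo a b, φ x * k x = ∫ x in Ioo a b, φ x * h x :=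
        setIntegral_congr_fun measurableSet_Ioo fun x hx => by
          rw [hkh x (Ioo_subset_Icc_self hx)]
      have hi : ∀ F : ℝ → ℝ, ContinuousOn F (Icc a b) →
          IntegrableOn (fun x => deriv φ x * F x) (Ioo a b) := fun F hF =>
        ((hφ.continuous_deriv.continuousOn.mul hF).integrableOn_Icc).mono_set Ioo_subset_Icc_self
      simp only [Pi.sub_apply, mul_sub]
      rw [integral_sub (hi _ hg) (hi _ hdc.continuousOn), h1, h2, H φ hφ, sub_self]
  intro x hx
  rw [← hkh x hx]
  refine ((hd x).hasDerivWithinAt.const_add c).congr_of_mem (fun y hy => ?_) hx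
  have : g y - ∫ s in a..y, k s = c := hc hy
  change g y = c + ∫ s in a..y, k s
  linarith

/-! ### Every weak solution is given by Duhamel's formula -/

theorem inner_dy_sineH1 {v : H1} (hv : v ∈ H10) (n : ℕ) :
    inner ℝ v.dy (sineH1 n).dy = freq n ^ 2 * sineBasis.repr v.toL2 n := by
  have h := inner_sineH1 hv n
  rw [inner_H1] at h
  change inner ℝ v.toL2 (sine n) + _ = _ at h
  rw [HilbertBasis.repr_apply_apply, coe_sineBasis, real_inner_comm (v.toL2)]
  linarith

theorem repr_eq_inner (f : L2) (n : ℕ) : sineBasis.repr f n = inner ℝ f (sine n) := by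
  rw [HilbertBasis.repr_apply_apply, coe_sineBasis, real_inner_comm]

/-- The `n`-th sine coefficient as a continuous linear functional. -/
def coeffL (n : ℕ) : L2 →L[ℝ] ℝ :=
  (lp.evalCLM ℝ (fun _ : ℕ => ℝ) 2 n).comp (sineBasis.repr.toContinuousLinearEquiv : L2 →L[ℝ] _)

theorem coeffL_apply (n : ℕ) (f : L2) : coeffL n f = sineBasis.repr f n := rfl

/-- Weak solutions satisfy Duhamel's formula. -/
theorem IsWeakSolution.eq_duhamel {X : ℝ} (hX : 0 < X) {u₀ : H10} {f : ℝ → L2} (hf : Continuous f)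
    {u : ℝ → H1} (hu : IsWeakSolution X u₀ f u) {x : ℝ} (hx : x ∈ Icc 0 X) :
    u x = position (duhamel (ofPosition u₀) f x) := by
  obtain ⟨z, ⟨-, hz⟩, hzf⟩ := hu.weak_form
  refine H1.ext_repr fun n => ?_
  set c : ℝ → ℝ := fun x => sineBasis.repr (u x).toL2 n with hcdef
  set d : ℝ → ℝ := fun x => sineBasis.repr (dx X u x) n with hddef
  have hcd : ∀ x ∈ Icc 0 X, HasDerivWithinAt c (d x) (Icc 0 X) x := fun x hx =>
    (coeffL n).hasFDerivAt.comp_hasDerivWithinAt x (hu.memHX.differentiableOn x hx).hasDerivWithinAt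
  have hcc : ContinuousOn c (Icc 0 X) := fun x hx => (hcd x hx).continuousWithinAt
  have hdc : ContinuousOn d (Icc 0 X) := (coeffL n).continuous.comp_continuousOn hu.memHX.continuousOn_dx
  have hrc : Continuous fun x => sineBasis.repr (f x) n := continuous_repr hf n
  -- Testing the equation with the n-th sine gives d' = -ω² c + f_n weakly; the right-hand side is
  -- continuous, so the derivative is classical.
  have hdd := hasDerivWithinAt_of_weak hX (g := d)
    (h := fun x => -(freq n ^ 2 * c x) + sineBasis.repr (f x) n) hdc
    ((hcc.const_smul (freq n ^ 2)).neg.add hrc.continuousOn) (fun φ hφ => by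
      have h1 := hz ⟨sineH1 n, sineH1_mem n⟩ φ hφ
      have h2 : ∀ x, d x = inner ℝ (dx X u x) (sineH1 n).toL2 := fun x => repr_eq_inner _ n
      simp only [h2]
      rw [h1]
      congr 1
      refine integral_congr_ae ?_
      filter_upwards [hzf ⟨sineH1 n, sineH1_mem n⟩, ae_restrict_mem measurableSet_Ioo] with x hx hx'
      have hx : z x _ + inner ℝ (u x).dy (sineH1 n).dy = inner ℝ (f x) (sine n) := hx
      rw [inner_dy_sineH1 (hu.mem_H10 x (Ioo_subset_Icc_self hx')) n] at hx
      rw [← repr_eq_inner] at hx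
      rw [← hx]
      ring)
  -- The difference of the two solutions, times the integrating factor exp(iωx), has zero derivative
  -- and vanishes at 0.
  set w : ℝ → ℂ := fun x => Complex.exp ((freq n * x : ℝ) * Complex.I) *
    ((freq n * c x : ℝ) + (d x : ℂ) * Complex.I - duhamel (ofPosition u₀) f x n) with hwdef
  have hw : ∀ x ∈ Icc 0 X, HasDerivWithinAt w 0 (Icc 0 X) x := by
    intro x hx
    have h0 : HasDerivAt (fun x : ℝ => ((freq n * x : ℝ) : ℂ) * Complex.I)
        (freq n * Complex.I) x := by
      have := (((hasDerivAt_id x).const_mul (freq n)).ofReal_comp).mul_const Complex.I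
      exact this.congr_deriv (by push_cast; ring)
    have h1 := ((hcd x hx).const_mul (freq n)).ofReal_comp
    have h2 := (hdd x hx).ofReal_comp.mul_const Complex.I
    have h3 := (h1.add h2).sub (hasDerivAt_duhamel_apply hf (ofPosition u₀) x n).hasDerivWithinAt
    refine (h0.cexp.hasDerivWithinAt.mul h3).congr_deriv ?_
    simp only [Pi.add_apply, Pi.sub_apply]
    push_cast
    linear_combination (Complex.exp ((freq n * x : ℂ) * Complex.I) * (freq n * d x)) * Complex.I_sq
  have hconst := constant_of_has_deriv_right_zero (a := 0) (b := X) (f := w)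
    (fun x hx => (hw x hx).continuousWithinAt)
    (fun x hx => (hw x (Ico_subset_Icc_self hx)).mono_of_mem_nhdsWithin
      (Icc_mem_nhdsGE_of_mem hx)) x hx
  have hw0 : w 0 = 0 := by
    have hc0 : c 0 = sineBasis.repr (u₀ : H1).toL2 n := by rw [hcdef]; simp only [hu.initial]
    have hd0 : d 0 = 0 := by
      rw [hddef]
      exact (congrArg (coeffL n) hu.initial_dx).trans (map_zero (coeffL n))
    have hz0 : duhamel (ofPosition u₀) f 0 n = (freq n * c 0 : ℝ) := by
      rw [duhamel_zero, ofPosition_apply, hc0]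
    rw [hwdef]
    simp only [hz0, hd0]
    simp
  rw [hw0, hwdef] at hconst
  have h4 := (mul_eq_zero.1 hconst).resolve_left (Complex.exp_ne_zero _)
  have h5 : freq n * c x = (duhamel (ofPosition u₀) f x n).re := by
    have := congrArg Complex.re (sub_eq_zero.1 h4)
    simpa using this
  rw [repr_position, ← h5, mul_div_cancel_left₀ _ (freq_pos n).ne']

/-! ### Duhamel's formula gives a weak solution -/

/-- `u` is a continuous path in `H¹(0,1)`, continuously differentiable in `L²(0,1)` with
derivative `v`. -/
structure HasVelocity (u : ℝ → H1) (v : ℝ → L2) : Prop where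
  continuous : Continuous u
  continuous_velocity : Continuous v
  hasDerivAt : ∀ x, HasDerivAt (fun s => (u s).toL2) (v x) x

namespace HasVelocity
variable {u w : ℝ → H1} {v v' : ℝ → L2}

theorem dx_eq (h : HasVelocity u v) {X : ℝ} (hX : 0 < X) {x : ℝ} (hx : x ∈ Icc 0 X) :
    dx X u x = v x :=
  (h.hasDerivAt x).hasDerivWithinAt.derivWithin (uniqueDiffOn_Icc hX x hx)

theorem memHX (h : HasVelocity u v) {X : ℝ} (hX : 0 < X) : MemHX X u where
  continuousOn := h.continuous.continuousOn
  differentiableOn x _ := (h.hasDerivAt x).hasDerivWithinAt.differentiableWithinAt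
  continuousOn_dx := h.continuous_velocity.continuousOn.congr fun _ hx => h.dx_eq hX hx

theorem sub (h : HasVelocity u v) (h' : HasVelocity w v') : HasVelocity (u - w) (v - v') where
  continuous := h.continuous.sub h'.continuous
  continuous_velocity := h.continuous_velocity.sub h'.continuous_velocity
  hasDerivAt x := (h.hasDerivAt x).sub (h'.hasDerivAt x)

theorem zero : HasVelocity 0 0 where
  continuous := continuous_const
  continuous_velocity := continuous_const
  hasDerivAt x := hasDerivAt_const x _

end HasVelocity

section functionals
variable {E : Type*} [NormedAddCommGroup E] [NormedSpace ℝ E] {ζ : ℝ → E →L[ℝ] ℝ}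

theorem continuous_functional_apply (hζ : Continuous ζ) (ψ : E) : Continuous fun x => ζ x ψ :=
  hζ.clm_apply continuous_const

theorem memLp_functional (hζ : Continuous ζ) (X : ℝ) : MemLp ζ 2 (volume.restrict (Ioo 0 X)) := by
  obtain ⟨C, hC⟩ := isCompact_Icc.exists_bound_of_continuousOn (s := Icc (0 : ℝ) X)
    hζ.continuousOn
  refine MemLp.of_bound hζ.aestronglyMeasurable C ?_
  filter_upwards [ae_restrict_mem measurableSet_Ioo] with x hx
  exact hC x (Ioo_subset_Icc_self hx)

theorem continuous_inner_functional {F : Type*} [NormedAddCommGroup F] [InnerProductSpace ℝ F]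
    {f g : ℝ → F} (hf : Continuous f) (hg : Continuous g)
    (S T : E →L[ℝ] F) :
    Continuous fun x => (innerSL ℝ (f x)).comp S - (innerSL ℝ (g x)).comp T :=
  (((innerSL ℝ).continuous.comp hf).clm_comp continuous_const).sub
    (((innerSL ℝ).continuous.comp hg).clm_comp continuous_const)

/-- Integrating on `s` gives A x - A 0 = ∫ζ there, and an identity of continuous functionals extends
by density. It is then differentiated at an arbitrary ψ. This passes from sines to all of H¹₀. -/
theorem hasDerivAt_functional {A : ℝ → E →L[ℝ] ℝ} (hζ : Continuous ζ) {s : Set E}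
    (hs : Dense (Submodule.span ℝ s : Set E))
    (h : ∀ ψ ∈ s, ∀ x, HasDerivAt (fun x => A x ψ) (ζ x ψ) x) (ψ : E) (x : ℝ) :
    HasDerivAt (fun x => A x ψ) (ζ x ψ) x := by
  have hint : ∀ x ψ, (∫ s in (0 : ℝ)..x, ζ s) ψ = ∫ s in (0 : ℝ)..x, ζ s ψ := fun x ψ =>
    ((ContinuousLinearMap.apply ℝ ℝ ψ).intervalIntegral_comp_comm
      (hζ.intervalIntegrable (μ := volume) 0 x)).symm
  have hAB : ∀ x, A x - A 0 = ∫ s in (0 : ℝ)..x, ζ s := fun x =>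
    ContinuousLinearMap.ext_on hs fun ψ hψ => by
      rw [hint, intervalIntegral.integral_eq_sub_of_hasDerivAt (fun x _ => h ψ hψ x)
        ((continuous_functional_apply hζ ψ).intervalIntegrable 0 x)]
      rfl
  have he : (fun x => A x ψ) = fun x => A 0 ψ + ∫ s in (0 : ℝ)..x, ζ s ψ := by
    ext x
    rw [← hint, ← hAB, sub_apply]
    ring
  rw [he]
  exact ((continuous_functional_apply hζ ψ).integral_hasStrictDerivAt 0 x).hasDerivAt.const_add _

end functionals

section
variable {f : ℝ → L2} (hf : Continuous f) (z₀ : Phase)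
include hf

theorem hasVelocity_duhamel :
    HasVelocity (fun x => position (duhamel z₀ f x)) (fun x => velocity (duhamel z₀ f x)) := by
  have hz := continuous_duhamel hf z₀
  have hv : Continuous fun x => velocity (duhamel z₀ f x) := velocity.continuous.comp hz
  refine ⟨continuous_subtype_val.comp (position.continuous.comp hz), hv, ?_⟩
  -- Coordinatewise derivatives do not by themselves give a derivative in the L² norm. The integral
  -- identity can be checked on coordinates, and its right-hand side is differentiable in norm.
  have key : ∀ x, (position (duhamel z₀ f x) : H1).toL2 = (position (duhamel z₀ f 0) : H1).toL2
      + ∫ s in (0 : ℝ)..x, velocity (duhamel z₀ f s) := by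
    intro x
    refine ext_repr fun n => ?_
    have h1 := (coeffL n).intervalIntegral_comp_comm (hv.intervalIntegrable (μ := volume) 0 x)
    have h2 : ∀ s, HasDerivAt (fun s => (duhamel z₀ f s n).re / freq n)
        (coeffL n (velocity (duhamel z₀ f s))) s := by
      intro s
      have := (Complex.reCLM.hasFDerivAt.comp_hasDerivAt s
        (hasDerivAt_duhamel_apply hf z₀ s n)).div_const (freq n)
      refine this.congr_deriv ?_
      rw [coeffL_apply, repr_velocity]
      have := (freq_pos n).ne'
      simp
      field_simp
    have h3 := intervalIntegral.integral_eq_sub_of_hasDerivAt (a := 0) (b := x) (fun s _ => h2 s)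
      (((coeffL n).continuous.comp hv).intervalIntegrable 0 x)
    rw [map_add, lp.coeFn_add, Pi.add_apply, ← coeffL_apply n (∫ s in (0 : ℝ)..x, _), ← h1, h3,
      repr_position, repr_position]
    ring
  intro x
  have he : (fun s => (position (duhamel z₀ f s) : H1).toL2) = _ := funext key
  rw [he]
  exact (hv.integral_hasStrictDerivAt 0 x).hasDerivAt.const_add _

/-- The second derivative `u_xx = u_yy + f` of the solution given by Duhamel's formula. -/
def secondDeriv (z₀ : Phase) (f : ℝ → L2) (x : ℝ) : H10 →L[ℝ] ℝ :=
  (innerSL ℝ (f x)).comp (toL2L.comp H10.subtypeL)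
    - (innerSL ℝ (position (duhamel z₀ f x) : H1).dy).comp (dyL.comp H10.subtypeL)

omit hf in
theorem secondDeriv_apply (x : ℝ) (ψ : H10) : secondDeriv z₀ f x ψ
    = inner ℝ (f x) (ψ : H1).toL2 - inner ℝ (position (duhamel z₀ f x) : H1).dy (ψ : H1).dy := rfl

theorem continuous_secondDeriv : Continuous (secondDeriv z₀ f) := by
  have h := @continuous_inner_functional H10 H10.normedAddCommGroup H10.normedSpace L2 _ _ _ _ hf (dyL.continuous.comp
    (continuous_subtype_val.comp (position.continuous.comp (continuous_duhamel hf z₀))))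
    (toL2L.comp H10.subtypeL) (dyL.comp H10.subtypeL)
  exact h

theorem hasDerivAt_inner_velocity (ψ : H10) (x : ℝ) :
    HasDerivAt (fun x => inner ℝ (velocity (duhamel z₀ f x)) (ψ : H1).toL2)
      (secondDeriv z₀ f x ψ) x := by
  have hsine : ∀ n s, HasDerivAt
      (fun s => inner ℝ (velocity (duhamel z₀ f s)) (sine n))
      (secondDeriv z₀ f s ⟨sineH1 n, sineH1_mem n⟩) s := by
    intro n s
    have := Complex.imCLM.hasFDerivAt.comp_hasDerivAt s (hasDerivAt_duhamel_apply hf z₀ s n)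
    simp only [← repr_eq_inner, repr_velocity]
    refine this.congr_deriv ?_
    rw [secondDeriv_apply, inner_dy_sineH1 (position _).2, repr_position]
    change _ = inner ℝ (f s) (sine n) - _
    rw [← repr_eq_inner]
    have := (freq_pos n).ne'
    simp
    field_simp
    ring
  have key := @hasDerivAt_functional H10 H10.normedAddCommGroup H10.normedSpace (secondDeriv z₀ f)
    (fun x => (innerSL ℝ (velocity (duhamel z₀ f x))).comp (toL2L.comp H10.subtypeL))
    (continuous_secondDeriv hf z₀) (range sineH10)
  refine key ?_ ?_ ψ x
  · have := sineH10Basis.dense_span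
    rw [coe_sineH10Basis] at this
    exact Submodule.dense_iff_topologicalClosure_eq_top.2 this
  · rintro _ ⟨n, rfl⟩ x
    have h := (hsine n x).const_mul (sineNorm n)⁻¹
    rw [sineH10]
    simp only [map_smul]
    exact h

/-- Duhamel's formula gives a weak solution. -/
theorem isWeakSolution_duhamel {X : ℝ} (hX : 0 < X) (u₀ : H10) :
    IsWeakSolution X u₀ f (fun x => position (duhamel (ofPosition u₀) f x)) where
  memHX := (hasVelocity_duhamel hf _).memHX hX
  mem_H10 x _ := (position _).2
  weak_form := by
    have hζ := continuous_secondDeriv hf (ofPosition u₀)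
    refine ⟨secondDeriv (ofPosition u₀) f, ⟨?_, fun ψ φ hφ => ?_⟩, fun ψ => ae_of_all _ fun x => ?_⟩
    · exact @memLp_functional H10 _ (by infer_instance) _ hζ X
    · have h := @continuous_functional_apply H10 _ (by infer_instance) _ hζ ψ
      rw [← integral_deriv_test_mul hX.le hφ (hasDerivAt_inner_velocity hf (ofPosition u₀) ψ) h]
      refine setIntegral_congr_fun measurableSet_Ioo fun x hx => ?_
      rw [(hasVelocity_duhamel hf _).dx_eq hX (Ioo_subset_Icc_self hx)]
    · rw [secondDeriv_apply]; ring
  initial := by rw [duhamel_zero, position_ofPosition]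
  initial_dx := by
    rw [(hasVelocity_duhamel hf _).dx_eq hX (left_mem_Icc.2 hX.le), duhamel_zero,
      velocity_ofPosition]

end

/-! ### Volterra fixed points and uniqueness -/

section volterra
variable {E : Type*} [NormedAddCommGroup E] [NormedSpace ℝ E]

theorem mul_integral_exp_mul_le {M c D x : ℝ} (hM : 0 < M) (hc : 0 ≤ c) (hD : 0 ≤ D)
    (hcM : 2 * c ≤ M) :
    Real.exp (-(M * x)) * (c * ∫ s in (0 : ℝ)..x, Real.exp (M * s) * D) ≤ 1 / 2 * D := by
  have h1 : ∫ s in (0 : ℝ)..x, Real.exp (M * s) * D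
      = Real.exp (M * x) / M * D - Real.exp (M * 0) / M * D := by
    refine intervalIntegral.integral_eq_sub_of_hasDerivAt
      (f := fun s => Real.exp (M * s) / M * D) (fun s _ => ?_)
      (Continuous.intervalIntegrable (by fun_prop) _ _)
    have := ((((hasDerivAt_id s).const_mul M).exp).div_const M).mul_const D
    refine this.congr_deriv ?_
    field_simp
    simp only [id, mul_comm]
  have h2 : Real.exp (-(M * x)) * Real.exp (M * x) = 1 := by
    rw [← Real.exp_add, neg_add_cancel, Real.exp_zero]
  have h3 := Real.exp_pos (-(M * x))
  rw [h1, mul_zero, Real.exp_zero]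
  calc Real.exp (-(M * x)) * (c * (Real.exp (M * x) / M * D - 1 / M * D))
      = c / M * D * (Real.exp (-(M * x)) * Real.exp (M * x)) - c / M * D * Real.exp (-(M * x)) := by
        ring
    _ ≤ c / M * D := by rw [h2]; have : 0 ≤ c / M * D * Real.exp (-(M * x)) := by positivity
                        linarith
    _ ≤ 1 / 2 * D := by
        refine mul_le_mul_of_nonneg_right ?_ hD
        rw [div_le_div_iff₀ hM two_pos]
        linarith

/-- Existence of fixed points of Volterra operators. -/
theorem exists_fixedPoint_volterra [CompleteSpace E] {X c : ℝ} (hX : 0 ≤ X) (hc : 0 ≤ c)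
    {S : (ℝ → E) → ℝ → E} (hS : ∀ v, Continuous v → Continuous (S v))
    (hSc : ∀ v w, Continuous v → Continuous w → ∀ x ∈ Icc 0 X,
      ‖S v x - S w x‖ ≤ c * ∫ s in (0 : ℝ)..x, ‖v s - w s‖) :
    ∃ v, Continuous v ∧ EqOn (S v) v (Icc 0 X) := by
  -- Any M ≥ 2c gives contraction factor 1/2; the extra 1 keeps M positive when c = 0.
  set M : ℝ := 2 * c + 1
  have hM : 0 < M := by positivity
  -- Writing v(s) = exp(Ms)·y(s), the sup norm of y is the weighted norm of v.
  let ext : C(Icc 0 X, E) → ℝ → E := fun y s => Real.exp (M * s) • IccExtend hX y s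
  have hext : ∀ y, Continuous (ext y) := fun y =>
    (by fun_prop : Continuous fun s => Real.exp (M * s)).smul y.continuous.Icc_extend'
  let Ψ : C(Icc 0 X, E) → C(Icc 0 X, E) := fun y =>
    ⟨fun x => Real.exp (-(M * x)) • S (ext y) x,
      (by fun_prop : Continuous fun x : Icc 0 X => Real.exp (-(M * (x : ℝ)))).smul
        ((hS _ (hext y)).comp continuous_subtype_val)⟩
  have hΨ : ContractingWith (1 / 2) Ψ := by
    refine ⟨by rw [← NNReal.coe_lt_coe]; norm_num, LipschitzWith.of_dist_le_mul fun y w => ?_⟩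
    rw [ContinuousMap.dist_le (by positivity)]
    intro x
    have hle : ∫ s in (0 : ℝ)..x, ‖ext y s - ext w s‖
        ≤ ∫ s in (0 : ℝ)..x, Real.exp (M * s) * dist y w := by
      refine intervalIntegral.integral_mono_on x.2.1
        (((hext y).sub (hext w)).norm.intervalIntegrable _ _)
        (Continuous.intervalIntegrable (by fun_prop) _ _) fun s _ => ?_
      rw [← smul_sub, norm_smul, Real.norm_of_nonneg (Real.exp_pos _).le]
      refine mul_le_mul_of_nonneg_left ?_ (Real.exp_pos _).le
      rw [← dist_eq_norm]
      exact ContinuousMap.dist_apply_le_dist _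
    rw [dist_eq_norm]
    change ‖Real.exp (-(M * x)) • S (ext y) x - Real.exp (-(M * x)) • S (ext w) x‖ ≤ _
    rw [← smul_sub, norm_smul, Real.norm_of_nonneg (Real.exp_pos _).le]
    have h2 := mul_integral_exp_mul_le (x := x) hM hc (dist_nonneg (x := y) (y := w))
      (by linarith : 2 * c ≤ M)
    refine le_trans (mul_le_mul_of_nonneg_left ((hSc _ _ (hext y) (hext w) x x.2).trans
      (mul_le_mul_of_nonneg_left hle hc)) (Real.exp_pos _).le) ?_
    simpa using h2
  set y := hΨ.fixedPoint
  have hy : Ψ y = y := hΨ.fixedPoint_isFixedPt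
  refine ⟨ext y, hext y, fun x hx => ?_⟩
  have h1 : Real.exp (-(M * x)) • S (ext y) x = y ⟨x, hx⟩ := congrArg (fun g => g ⟨x, hx⟩) hy
  change S (ext y) x = Real.exp (M * x) • IccExtend hX y x
  rw [IccExtend_of_mem hX _ hx, ← h1, smul_smul, ← Real.exp_add, add_neg_cancel, Real.exp_zero,
    one_smul]

omit [NormedSpace ℝ E] in
-- Grönwall is applied to the integral of ‖v - w‖, which is differentiable although the norm itself
-- need not be.
theorem eqOn_of_norm_sub_le_integral {X c : ℝ} {v w : ℝ → E} (hv : Continuous v) (hw : Continuous w)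
    (hc : 0 ≤ c)
    (h : ∀ x ∈ Icc 0 X, ‖v x - w x‖ ≤ c * ∫ s in (0 : ℝ)..x, ‖v s - w s‖) :
    EqOn v w (Icc 0 X) := by
  have hd : Continuous fun s => ‖v s - w s‖ := (hv.sub hw).norm
  have hD : ∀ x, HasDerivAt (fun x => ∫ s in (0 : ℝ)..x, ‖v s - w s‖) ‖v x - w x‖ x := fun x =>
    (hd.integral_hasStrictDerivAt 0 x).hasDerivAt
  intro x hx
  have h0 := norm_le_gronwallBound_of_norm_deriv_right_le (δ := 0) (K := c) (ε := 0) (a := 0)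
    (b := X) (fun x _ => (hD x).continuousAt.continuousWithinAt)
    (fun x _ => (hD x).hasDerivWithinAt) (by simp) (fun x hx => by
      rw [add_zero, norm_norm]
      exact (h x (Ico_subset_Icc_self hx)).trans
        (mul_le_mul_of_nonneg_left (Real.le_norm_self _) hc)) x hx
  rw [gronwallBound_ε0_δ0] at h0
  have h1 := h x hx
  rw [norm_le_zero_iff.1 h0, mul_zero] at h1
  exact sub_eq_zero.1 (norm_le_zero_iff.1 h1)

end volterra

/-! ### The norm of 𝓗_X and the Picard map -/

theorem IsWeakSolution.congr_rhs {X : ℝ} {u₀ : H1} {f g : ℝ → L2} {u : ℝ → H1}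
    (hu : IsWeakSolution X u₀ f u) (hfg : EqOn f g (Icc 0 X)) : IsWeakSolution X u₀ g u where
  memHX := hu.memHX
  mem_H10 := hu.mem_H10
  weak_form := by
    obtain ⟨z, hz, h⟩ := hu.weak_form
    refine ⟨z, hz, fun ψ => ?_⟩
    filter_upwards [h ψ, ae_restrict_mem measurableSet_Ioo] with x hx hx'
    rw [hx, hfg (Ioo_subset_Icc_self hx')]
  initial := hu.initial
  initial_dx := hu.initial_dx

theorem normHX_nonneg (X : ℝ) (u : ℝ → H1) : 0 ≤ normHX X u :=
  add_nonneg (Real.iSup_nonneg fun _ => norm_nonneg _) (Real.iSup_nonneg fun _ => norm_nonneg _)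

namespace HasVelocity
variable {u w : ℝ → H1} {v v' : ℝ → L2} {X : ℝ}

theorem normHX_eq (h : HasVelocity u v) (hX : 0 < X) :
    normHX X u = (⨆ x : Icc (0 : ℝ) X, ‖u x‖) + ⨆ x : Icc (0 : ℝ) X, ‖v x‖ := by
  rw [normHX]
  congr 2
  ext x
  rw [h.dx_eq hX x.2]

theorem norm_le_iSup (h : HasVelocity u v) (x : Icc (0 : ℝ) X) :
    ‖u x‖ ≤ ⨆ x : Icc (0 : ℝ) X, ‖u x‖ :=
  le_ciSup (f := fun x : Icc (0 : ℝ) X => ‖u x‖)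
    (isCompact_range (h.continuous.norm.comp continuous_subtype_val)).bddAbove x

theorem norm_velocity_le_iSup (h : HasVelocity u v) (x : Icc (0 : ℝ) X) :
    ‖v x‖ ≤ ⨆ x : Icc (0 : ℝ) X, ‖v x‖ :=
  le_ciSup (f := fun x : Icc (0 : ℝ) X => ‖v x‖)
    (isCompact_range (h.continuous_velocity.norm.comp continuous_subtype_val)).bddAbove x

theorem norm_le_normHX (h : HasVelocity u v) {x : ℝ} (hx : x ∈ Icc 0 X) : ‖u x‖ ≤ normHX X u :=
  (h.norm_le_iSup ⟨x, hx⟩).trans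
    (le_add_of_nonneg_right (Real.iSup_nonneg fun _ => norm_nonneg _))

theorem normHX_le (h : HasVelocity u v) (hX : 0 < X) {A B : ℝ} (hA : ∀ x ∈ Icc 0 X, ‖u x‖ ≤ A)
    (hB : ∀ x ∈ Icc 0 X, ‖v x‖ ≤ B) : normHX X u ≤ A + B := by
  have : Nonempty (Icc 0 X) := ⟨⟨0, left_mem_Icc.2 hX.le⟩⟩
  rw [h.normHX_eq hX]
  exact add_le_add (ciSup_le fun x => hA x x.2) (ciSup_le fun x => hB x x.2)

theorem normHX_sub_le (h : HasVelocity u v) (h' : HasVelocity w v') (hX : 0 < X) :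
    normHX X (u - w) ≤ normHX X u + normHX X w := by
  rw [h.normHX_eq hX, h'.normHX_eq hX, add_add_add_comm]
  exact (h.sub h').normHX_le hX
    (fun x hx => (norm_sub_le _ _).trans
      (add_le_add (h.norm_le_iSup ⟨x, hx⟩) (h'.norm_le_iSup ⟨x, hx⟩)))
    (fun x hx => (norm_sub_le _ _).trans
      (add_le_add (h.norm_velocity_le_iSup ⟨x, hx⟩) (h'.norm_velocity_le_iSup ⟨x, hx⟩)))

end HasVelocity

section picard
variable (P : H1 →L[ℝ] L2) (u₀ : H10)

/-- The state of the solution of the wave equation with right-hand side `-P v`. -/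
def picardState (v : ℝ → H1) : ℝ → Phase := duhamel (ofPosition u₀) fun s => -P (v s)

/-- The solution of the wave equation with right-hand side `-P v`. -/
def picard (v : ℝ → H1) (x : ℝ) : H1 := position (picardState P u₀ v x)

variable {P} {v w : ℝ → H1}

theorem continuous_neg_comp (hv : Continuous v) : Continuous fun s => -P (v s) :=
  (P.continuous.comp hv).neg

theorem hasVelocity_picard (hv : Continuous v) :
    HasVelocity (picard P u₀ v) (fun x => velocity (picardState P u₀ v x)) :=
  hasVelocity_duhamel (continuous_neg_comp hv) _

theorem isWeakSolution_picard (hv : Continuous v) {X : ℝ} (hX : 0 < X) :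
    IsWeakSolution X u₀ (fun s => -P (v s)) (picard P u₀ v) :=
  isWeakSolution_duhamel (continuous_neg_comp hv) hX u₀

theorem eqOn_picard (hv : Continuous v) {X : ℝ} (hX : 0 < X) {u : ℝ → H1}
    (hu : IsWeakSolution X u₀ (fun s => -P (v s)) u) : EqOn u (picard P u₀ v) (Icc 0 X) :=
  fun _ hx => hu.eq_duhamel hX (continuous_neg_comp hv) hx

variable {a : ℝ} (hP : ∀ v, ‖P v‖ ≤ a * ‖v‖)
include hP

theorem norm_picardState_sub_le (hv : Continuous v) (hw : Continuous w) {x : ℝ} (hx : 0 ≤ x) :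
    ‖picardState P u₀ v x - picardState P u₀ w x‖ ≤ a * ∫ s in (0 : ℝ)..x, ‖v s - w s‖ := by
  refine (norm_duhamel_sub_le (continuous_neg_comp hv) _ (continuous_neg_comp hw) hx).trans ?_
  rw [← intervalIntegral.integral_const_mul]
  refine intervalIntegral.integral_mono_on hx
    (((continuous_neg_comp hv).sub (continuous_neg_comp hw)).norm.intervalIntegrable _ _)
    ((continuous_const.mul (hv.sub hw).norm).intervalIntegrable _ _) fun s _ => ?_
  rw [neg_sub_neg, ← map_sub, norm_sub_rev (v s)]
  exact hP _

theorem norm_picard_sub_le (hv : Continuous v) (hw : Continuous w) {x : ℝ} (hx : 0 ≤ x) :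
    ‖picard P u₀ v x - picard P u₀ w x‖
      ≤ 11 / 10 * a * ∫ s in (0 : ℝ)..x, ‖v s - w s‖ := by
  have h := norm_position_le (picardState P u₀ v x - picardState P u₀ w x)
  rw [map_sub] at h
  refine (show ‖picard P u₀ v x - picard P u₀ w x‖ ≤ _ from h).trans ?_
  rw [mul_assoc]
  exact mul_le_mul_of_nonneg_left (norm_picardState_sub_le u₀ hP hv hw hx) (by norm_num)

/-- The constant 21/10 is 11/10 for the position plus 1 for the velocity; the integral over [0,x]
contributes X. -/
theorem normHX_picard_sub_le (ha : 0 ≤ a) {v' w' : ℝ → L2} (hv : HasVelocity v v')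
    (hw : HasVelocity w w') {X : ℝ} (hX : 0 < X) :
    normHX X (picard P u₀ v - picard P u₀ w) ≤ 21 / 10 * (a * X) * normHX X (v - w) := by
  set N := normHX X (v - w)
  have hint : ∀ x ∈ Icc 0 X, ∫ s in (0 : ℝ)..x, ‖v s - w s‖ ≤ X * N := by
    intro x hx
    have h1 : ∫ s in (0 : ℝ)..x, ‖v s - w s‖ ≤ ∫ _ in (0 : ℝ)..x, N :=
      intervalIntegral.integral_mono_on hx.1
        ((hv.continuous.sub hw.continuous).norm.intervalIntegrable _ _)
        (continuous_const.intervalIntegrable _ _) fun s hs =>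
          (hv.sub hw).norm_le_normHX ⟨hs.1, hs.2.trans hx.2⟩
    rw [intervalIntegral.integral_const, sub_zero, smul_eq_mul] at h1
    exact h1.trans (mul_le_mul_of_nonneg_right hx.2 (normHX_nonneg _ _))
  have h := ((hasVelocity_picard (P := P) u₀ hv.continuous).sub
    (hasVelocity_picard u₀ hw.continuous)).normHX_le hX
    (A := 11 / 10 * a * (X * N)) (B := a * (X * N))
    (fun x hx => (norm_picard_sub_le u₀ hP hv.continuous hw.continuous hx.1).trans
      (mul_le_mul_of_nonneg_left (hint x hx) (by positivity)))
    (fun x hx => by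
      rw [Pi.sub_apply, ← map_sub]
      exact (norm_velocity_le _).trans
        ((norm_picardState_sub_le u₀ hP hv.continuous hw.continuous hx.1).trans
          (mul_le_mul_of_nonneg_left (hint x hx) ha)))
  linarith

/-- Existence and uniqueness for the wave equation perturbed by a bounded operator. -/
theorem exists_unique_weakSolution (ha : 0 ≤ a) {X : ℝ} (hX : 0 < X) :
    ∃ (u : ℝ → H1) (u' : ℝ → L2), HasVelocity u u' ∧ EqOn (picard P u₀ u) u (Icc 0 X) ∧
      IsWeakSolution X u₀ (fun s => -P (u s)) u ∧
      ∀ w, IsWeakSolution X u₀ (fun s => -P (w s)) w → EqOn w u (Icc 0 X) := by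
  have hc : 0 ≤ 11 / 10 * a := by positivity
  obtain ⟨v, hv, hvS⟩ := exists_fixedPoint_volterra hX.le hc (S := picard P u₀)
    (fun v hv => (hasVelocity_picard u₀ hv).continuous)
    (fun v w hv hw x hx => norm_picard_sub_le u₀ hP hv hw hx.1)
  -- The fixed point v is only known to be continuous; its image under `picard` agrees with it on
  -- [0,X] and has a velocity.
  have hu := hasVelocity_picard (P := P) u₀ hv
  have huS : EqOn (picard P u₀ (picard P u₀ v)) (picard P u₀ v) (Icc 0 X) := by
    intro x hx
    have h := norm_picard_sub_le u₀ hP hu.continuous hv hx.1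
    have h0 : ∫ s in (0 : ℝ)..x, ‖picard P u₀ v s - v s‖ = 0 := by
      refine (intervalIntegral.integral_congr (g := fun _ => 0) fun s hs => ?_).trans (by simp)
      rw [uIcc_of_le hx.1] at hs
      simp only [hvS ⟨hs.1, hs.2.trans hx.2⟩, sub_self, norm_zero]
    rw [h0, mul_zero] at h
    exact sub_eq_zero.1 (norm_le_zero_iff.1 h)
  refine ⟨_, _, hu, huS, (isWeakSolution_picard u₀ hv hX).congr_rhs fun x hx => ?_, fun w hw => ?_⟩
  · simp only [hvS hx]
  -- A competing solution is controlled only on [0,X], so it is extended constantly to a continuous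
  -- path on the line.
  · set W : ℝ → H1 := IccExtend hX.le ((Icc 0 X).domRestrict w)
    have hW : Continuous W :=
      (continuousOn_iff_continuous_domRestrict.1 hw.memHX.continuousOn).Icc_extend'
    have hWw : EqOn W w (Icc 0 X) := fun x hx => IccExtend_of_mem _ _ hx
    have hwS := eqOn_picard (P := P) u₀ hW hX (hw.congr_rhs fun x hx => by simp only [hWw hx])
    refine hWw.symm.trans (eqOn_of_norm_sub_le_integral hW hu.continuous hc fun x hx => ?_)
    rw [hWw hx, hwS hx, ← huS hx]
    exact norm_picard_sub_le u₀ hP hW hu.continuous hx.1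

end picard

/-! ### The iteration, the constant η and the conclusion -/

/-- The linearized iteration. -/
def picardIterate (P : H1 →L[ℝ] L2) (u₀ : H10) (k : ℕ) : ℝ → H1 := (picard P u₀)^[k] 0

theorem picardIterate_succ (P : H1 →L[ℝ] L2) (u₀ : H10) (k : ℕ) :
    picardIterate P u₀ (k + 1) = picard P u₀ (picardIterate P u₀ k) :=
  Function.iterate_succ_apply' _ _ _

theorem exists_hasVelocity_picardIterate (P : H1 →L[ℝ] L2) (u₀ : H10) (k : ℕ) :
    ∃ v, HasVelocity (picardIterate P u₀ k) v := by
  induction k with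
  | zero => exact ⟨0, HasVelocity.zero⟩
  | succ k ih =>
    obtain ⟨v, hv⟩ := ih
    rw [picardIterate_succ]
    exact ⟨_, hasVelocity_picard u₀ hv.continuous⟩

theorem normHX_congr {X : ℝ} {u w : ℝ → H1} (h : EqOn u w (Icc 0 X)) :
    normHX X u = normHX X w := by
  have hd : ∀ x ∈ Icc 0 X, dx X u x = dx X w x := fun x hx =>
    derivWithin_congr (fun s hs => by rw [h hs]) (by rw [h hx])
  rw [normHX, normHX]
  congr 2
  · ext x; rw [h x.2]
  · ext x; rw [hd x x.2]

/-- With t = C₁ log(g) x one has η² = 2t·exp(t), so the claim is 2.205 t ≤ exp(t) for t > 0. Already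
1 + t + t²/2 exceeds 2.205 t, the difference having negative discriminant. -/
theorem le_eta {C₁ g x : ℝ} (hC₁ : 0 ≤ C₁) (hg : 1 ≤ g) (hx : 0 ≤ x) :
    21 / 10 * (C₁ * Real.log g * x) ≤ eta C₁ g x := by
  have hl : 0 ≤ Real.log g := Real.log_nonneg hg
  set t := C₁ * Real.log g * x with ht
  have ht0 : 0 ≤ t := by positivity
  have he : g ^ (C₁ * x) = Real.exp t := by
    rw [Real.rpow_def_of_pos (by linarith)]
    congr 1
    ring
  rw [eta, he]
  refine Real.le_sqrt_of_sq_le ?_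
  have h1 := Real.quadratic_le_exp_of_nonneg ht0
  have h2 : 2 * C₁ * Real.log g * x * Real.exp t = 2 * (t * Real.exp t) := by rw [ht]; ring
  rw [h2]
  have h3 := mul_le_mul_of_nonneg_left h1 ht0
  nlinarith [mul_nonneg ht0 (sq_nonneg (t - 1.2))]

theorem tendsto_eta (C₁ : ℝ) {g : ℝ} (hg : 1 ≤ g) :
    Tendsto (fun x => eta C₁ g x) (𝓝[>] 0) (𝓝 0) := by
  have hc : Continuous fun x => eta C₁ g x := by
    have h1 : Continuous fun x : ℝ => g ^ (C₁ * x) :=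
      (Real.continuous_const_rpow (by linarith)).comp (continuous_const.mul continuous_id)
    unfold eta
    fun_prop
  have h := hc.tendsto 0
  have h0 : eta C₁ g 0 = 0 := by simp [eta]
  rw [h0] at h
  exact h.mono_left nhdsWithin_le_nhds

end QuasiReversibility

end

open QuasiReversibility in
theorem theorem5p1 (γ : ℝ → ℝ) (hγ : ∀ b ∈ Set.Ioo (0 : ℝ) 1, 1 ≤ γ b)
    (β : ℝ) (hβ : β ∈ Set.Ioo (0 : ℝ) 1)
    (C₁ : ℝ) (hC₁ : 0 < C₁)
    (P : H1 →ₗ[ℝ] L2) (hP : IsStabilizedOperator C₁ (γ β) P)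
    (u₀ : H1) (hu₀ : u₀ ∈ H10) :
    Tendsto (fun xbar : ℝ => eta C₁ (γ β) xbar) (𝓝[>] 0) (𝓝 0) ∧
    ∀ X xbar : ℝ, 0 < xbar → xbar ≤ X → X ≤ 1 → eta C₁ (γ β) xbar < 1 →
      ∃ (u : ℝ → H1) (U : ℕ → ℝ → H1),
        IsRegularizedSolution P X u₀ u ∧
        (∀ u', IsRegularizedSolution P X u₀ u' → Set.EqOn u' u (Set.Icc 0 X)) ∧
        IsLinearizedIteration P X u₀ U ∧
        (∀ U', IsLinearizedIteration P X u₀ U' → ∀ k, Set.EqOn (U' k) (U k) (Set.Icc 0 X)) ∧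
        MemHX xbar u ∧ (∀ k, MemHX xbar (U k)) ∧
        Tendsto (fun k => normHX xbar (U k - u)) atTop (𝓝 0) ∧
        ∀ k : ℕ, normHX xbar (U k - u)
          ≤ eta C₁ (γ β) xbar ^ k / (1 - eta C₁ (γ β) xbar) * normHX xbar (U 1) := by
  have hg := hγ β hβ
  refine ⟨tendsto_eta C₁ hg, fun X xbar hx0 hxX _ hη => ?_⟩
  have hX : 0 < X := hx0.trans_le hxX
  set a := C₁ * Real.log (γ β)
  have ha : 0 ≤ a := mul_nonneg hC₁.le (Real.log_nonneg hg)
  have hPa : ∀ v, ‖P v‖ ≤ a * ‖v‖ := hP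
  let Q : H1 →L[ℝ] L2 := P.mkContinuous a hPa
  let p : H10 := ⟨u₀, hu₀⟩
  have hQ : ∀ v, ‖Q v‖ ≤ a * ‖v‖ := hPa
  obtain ⟨u, u', hu, huS, huW, huU⟩ := exists_unique_weakSolution p hQ ha hX
  set U := picardIterate Q p with hUdef
  choose U' hU using exists_hasVelocity_picardIterate Q p
  have hUW : ∀ k, IsWeakSolution X u₀ (fun s => -Q (U k s)) (U (k + 1)) := fun k => by
    rw [hUdef, picardIterate_succ]
    exact isWeakSolution_picard p (hU k).continuous hX
  set η := eta C₁ (γ β) xbar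
  have hη0 : 0 ≤ η := Real.sqrt_nonneg _
  have hstep : ∀ k, normHX xbar (U (k + 1) - u) ≤ η * normHX xbar (U k - u) := by
    intro k
    have h1 : normHX xbar (U (k + 1) - u) = normHX xbar (picard Q p (U k) - picard Q p u) :=
      normHX_congr fun x hx => by
        rw [hUdef, picardIterate_succ, Pi.sub_apply, Pi.sub_apply, huS ⟨hx.1, hx.2.trans hxX⟩]
    rw [h1]
    exact (normHX_picard_sub_le p hQ ha (hU k) hu hx0).trans
      (mul_le_mul_of_nonneg_right (le_eta hC₁.le hg hx0.le) (normHX_nonneg _ _))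
  have hgeom : ∀ k, normHX xbar (U k - u) ≤ η ^ k * normHX xbar (U 0 - u) := by
    intro k
    induction k with
    | zero => simp
    | succ k ih =>
      refine (hstep k).trans ((mul_le_mul_of_nonneg_left ih hη0).trans (le_of_eq ?_))
      ring
  -- As u⁰ = 0, the triangle inequality and one contraction step give ‖u⁰-u‖ ≤ ‖u¹-u‖ + ‖u¹‖ ≤
  -- η‖u⁰-u‖ + ‖u¹‖.
  have hzero : normHX xbar (U 0 - u) ≤ normHX xbar (U 1) / (1 - η) := by
    have h1 : U 0 - u = (U 1 - u) - U 1 := by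
      have : U 0 = 0 := rfl
      rw [this]; abel
    have h2 := ((hU 1).sub hu).normHX_sub_le (hU 1) hx0
    have h3 := hstep 0
    rw [le_div_iff₀ (by linarith)]
    rw [← hUdef, ← h1] at h2
    rw [zero_add] at h3
    linarith
  have hest : ∀ k, normHX xbar (U k - u) ≤ η ^ k / (1 - η) * normHX xbar (U 1) := fun k =>
    (hgeom k).trans ((mul_le_mul_of_nonneg_left hzero (pow_nonneg hη0 k)).trans
      (le_of_eq (by ring)))
  refine ⟨u, U, huW, huU, ⟨fun _ _ => rfl, hUW⟩, fun V hV k => ?_, hu.memHX hx0,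
    fun k => (hU k).memHX hx0, ?_, hest⟩
  -- Agreement of the k-th iterates on [0,X] gives equal right-hand sides there, and a weak solution
  -- is determined by its right-hand side.
  · induction k with
    | zero => exact fun x hx => hV.1 x hx
    | succ k ih =>
      rw [hUdef, picardIterate_succ]
      refine eqOn_picard (P := Q) p (hU k).continuous hX ((hV.2 k).congr_rhs fun x hx => ?_)
      simp only [ih hx]
      rfl
  · have h1 : Tendsto (fun k => η ^ k * normHX xbar (U 0 - u)) atTop (𝓝 0) := by
      simpa using (tendsto_pow_atTop_nhds_zero_of_lt_one hη0 hη).mul_const _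
    exact squeeze_zero (fun k => normHX_nonneg _ _) hgeom h1
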